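/- Let $T>0$. For $a\in\mathbb R^2$ write $a^\perp=(-a_2,a_1)$, and for $p\in\mathbb R^2$ write $\widehat p=p/\sqrt{1+|p|^2}$. For a function $f=f(t,x,p)$ on $[0,T]\times\mathbb R^2\times\mathbb R^2$ put $\rho_f=4\pi\int_{\mathbb R^2} f\,dp$ and $j_f=4\pi\int_{\mathbb R^2}\widehat p f\,dp$. Let $U:[0,T]\times\mathbb R^2\to\mathbb R^2$ be an external current that is continuous on $[0,T]\times\mathbb R^2$, differentiable in $x$, and whose first $x$-derivatives are continuous on $[0,T]\times\mathbb R^2$. Let $\mathring f:\mathbb R^2\times\mathbb R^2\to\mathbb R$, $\mathring E:\mathbb R^2\to\mathbb R^2$ and $\mathring B:\mathbb R^2\to\mathbb R$ be given initial data. Consider the controlled two-dimensional relativistic Vlasov–Maxwell system on $[0,T]$ for $f=f(t,x,p)\in\mathbb R$, $E=E(t,x)\in\mathbb R^2$, $B=B(t,x)\in\mathbb R$: $$ \begin{aligned} \partial_t f+\widehat p\cdot\partial_x f+(E-\widehat p^\perp B)\cdot\partial_p f&=0,\\ \partial_t E_1-\partial_{x_2}B&=-j_{f,1}-U_1,\\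 \partial_t E_2+\partial_{x_1}B&=-j_{f,2}-U_2,\\ \partial_t B+\partial_{x_1}E_2-\partial_{x_2}E_1&=0,\\ \operatorname{div}_x E&=\rho_f-\int_0^t\operatorname{div}_xU\,d\tau,\\ (f,E,B)|_{t=0}&=(\mathring f,\mathring E,\mathring B). \end{aligned} $$ A triple $(f,E,B)$ is called a solution if the five differential equations, with weak derivatives, hold pointwise almost everywhere, and the initial condition holds in the sense of $C([0,T];L^2)$, that is, $f$ and every component of $E$ and $B$ agree, for almost every $t$, with a continuous map from $[0,T]$ to $L^2$ whose value at $t=0$ is the prescribed initial datum. Then there is, up to equality almost everywhere, at most one solution $(f,E,B)$ with the two properties 1. $f\in W^{1,\infty}\cap H^1$ on $(0,T)\times\mathbb R^2\times\mathbb R^2$, and $E,B\in W^{1,\infty}\cap H^1$ on $(0,T)\times\mathbb R^2$; 2. there is $r>0$ (which may depend on the solution) such that $\operatorname{supp} f\subset[0,T]\times B_r\times B_r$, where $B_r$ is the open ball of radius $r$ about $0$ in $\mathbb R^2$. That is, if $(f,E,B)$ and $(\widetilde f,\widetilde E,\widetilde B)$ both have these properties and solve the system with the same $T$, $U$, $\mathring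 f$, $\mathring E$, $\mathring B$, then $f=\widetilde f$, $E=\widetilde E$ and $B=\widetilde B$ almost everywhere. -/

import Mathlib

open MeasureTheory Set Filter Topology
open scoped ContDiff ENNReal

namespace VlasovMaxwell

noncomputable section

/-! ### Weak derivatives and first order Sobolev classes -/

section Sobolev

variable {V : Type*} [NormedAddCommGroup V] [NormedSpace ℝ V] [MeasureSpace V]

/-- `g` is a weak derivative of `u` in the direction `v` on the open set `Ω`: both functions are
locally integrable on `Ω`, and `∫_Ω u ∂_v φ = - ∫_Ω g φ` for every test function
`φ ∈ C_c^∞(Ω)`. -/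
structure HasWeakDeriv (Ω : Set V) (v : V) (u g : V → ℝ) : Prop where
  locallyIntegrableOn : LocallyIntegrableOn u Ω
  locallyIntegrableOn_deriv : LocallyIntegrableOn g Ω
  integral_eq : ∀ φ : V → ℝ, ContDiff ℝ ∞ φ → HasCompactSupport φ → tsupport φ ⊆ Ω →
    ∫ z in Ω, u z * fderiv ℝ φ z v = - ∫ z in Ω, g z * φ z

/-- Weak derivatives on an open set are unique almost everywhere. -/
theorem HasWeakDeriv.ae_eq [FiniteDimensional ℝ V] [BorelSpace V]
    {Ω : Set V} (hΩ : IsOpen Ω) {v : V} {u g h : V → ℝ}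
    (hg : HasWeakDeriv Ω v u g) (hh : HasWeakDeriv Ω v u h) :
    g =ᵐ[volume.restrict Ω] h := by
  have key : ∀ k : V → ℝ, LocallyIntegrableOn k Ω → ∀ φ : V → ℝ, ContDiff ℝ ∞ φ →
      HasCompactSupport φ → tsupport φ ⊆ Ω → Integrable (fun z => φ z * k z) := by
    intro k hk φ hφ hc hs
    have h1 : IntegrableOn k (tsupport φ) :=
      hk.integrableOn_compact_subset hs hc
    have h2 : IntegrableOn (fun z => φ z * k z) (tsupport φ) :=
      h1.continuousOn_mul hφ.continuous.continuousOn hc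
    refine (integrableOn_iff_integrable_of_support_subset ?_).1 h2
    intro z hz
    apply subset_tsupport
    intro h0
    exact hz (by simp [h0])
  have hmain := hΩ.ae_eq_zero_of_integral_contDiff_smul_eq_zero
    (μ := volume) (f := fun z => g z - h z)
    (hg.locallyIntegrableOn_deriv.sub hh.locallyIntegrableOn_deriv) (by
      intro φ hφ hc hs
      have e := (hg.integral_eq φ hφ hc hs).symm.trans (hh.integral_eq φ hφ hc hs)
      have hset : ∀ k : V → ℝ, ∫ z in Ω, k z * φ z = ∫ z, φ z * k z := by
        intro k
        rw [setIntegral_eq_integral_of_forall_compl_eq_zero]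
        · simp_rw [mul_comm]
        · intro z hz
          rw [image_eq_zero_of_notMem_tsupport (fun h0 => hz (hs h0)), mul_zero]
      rw [hset, hset] at e
      simp only [smul_eq_mul, mul_sub]
      rw [integral_sub (key g hg.locallyIntegrableOn_deriv φ hφ hc hs)
        (key h hh.locallyIntegrableOn_deriv φ hφ hc hs)]
      linarith)
  rw [Filter.EventuallyEq, ae_restrict_iff' hΩ.measurableSet]
  filter_upwards [hmain] with z hz hzΩ
  exact sub_eq_zero.1 (hz hzΩ)

open Classical in
/-- The weak derivative of `u` in the direction `v` on `Ω` (well defined up to null sets, see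
`HasWeakDeriv.ae_eq`). The value `0` is taken if no weak derivative exists. -/
def weakDeriv (Ω : Set V) (v : V) (u : V → ℝ) : V → ℝ :=
  if h : ∃ g, HasWeakDeriv Ω v u g then h.choose else 0

/-- `u ∈ W^{1,q}(Ω)`: the function `u` lies in `L^q(Ω)` and has weak derivatives in `L^q(Ω)` in all
directions. The class `H¹` is the case `q = 2`. -/
def MemW1 (Ω : Set V) (q : ℝ≥0∞) (u : V → ℝ) : Prop :=
  MemLp u q (volume.restrict Ω) ∧
    ∀ v : V, ∃ g : V → ℝ, HasWeakDeriv Ω v u g ∧ MemLp g q (volume.restrict Ω)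

end Sobolev

/-! ### Space, time, initial values -/

/-- The plane `ℝ²`. -/
abbrev Plane : Type := EuclideanSpace ℝ (Fin 2)

/-- The open time slab `(0,T) × Y`. -/
def slab (T : ℝ) (Y : Type*) : Set (ℝ × Y) := Ioo 0 T ×ˢ univ

/-- `u(0) = u₀` in the sense of `C([0,T]; L²(Y))`: the function `t ↦ u(t,·)` agrees for almost every
`t ∈ (0,T)` with a continuous map `w : [0,T] → L²(Y)`, and `w(0) = u₀` (almost everywhere). -/
def HasInitialValue {Y : Type*} [MeasureSpace Y] (T : ℝ) (u : ℝ × Y → ℝ) (u₀ : Y → ℝ) : Prop :=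
  ∃ w : ℝ → Lp ℝ 2 (volume : Measure Y),
    ContinuousOn w (Icc 0 T) ∧
    (∀ᵐ t ∂(volume.restrict (Ioo 0 T)), (fun y => u (t, y)) =ᵐ[volume] w t) ∧
    u₀ =ᵐ[volume] w 0

/-! ### Kinetic quantities -/

/-- The relativistic velocity `p̂ = p / √(1 + |p|²)`. -/
def vel (p : Plane) : Plane := (Real.sqrt (1 + ‖p‖ ^ 2))⁻¹ • p

/-- `a^⊥ = (-a₂, a₁)`. -/
def perp (a : Plane) : Plane := !₂[-a 1, a 0]

/-- `ρ_f(t,x) = 4π ∫ f(t,x,p) dp`. -/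
def chargeDensity (f : ℝ × Plane × Plane → ℝ) (z : ℝ × Plane) : ℝ :=
  4 * Real.pi * ∫ p : Plane, f (z.1, z.2, p)

/-- The components of `j_f(t,x) = 4π ∫ p̂ f(t,x,p) dp`. -/
def currentDensity (f : ℝ × Plane × Plane → ℝ) (i : Fin 2) (z : ℝ × Plane) : ℝ :=
  4 * Real.pi * ∫ p : Plane, vel p i * f (z.1, z.2, p)

/-! ### Weak partial derivatives -/

/-- `i`-th standard basis vector of `ℝ²`. -/
def basisVec (i : Fin 2) : Plane := EuclideanSpace.single i 1

/-- `∂_t f` for `f = f(t,x,p)` on `(0,T) × ℝ² × ℝ²`. -/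
def kinDt (T : ℝ) (f : ℝ × Plane × Plane → ℝ) : ℝ × Plane × Plane → ℝ :=
  weakDeriv (slab T (Plane × Plane)) (1, 0, 0) f

/-- `∂_{x_i} f` for `f = f(t,x,p)`. -/
def kinDx (T : ℝ) (i : Fin 2) (f : ℝ × Plane × Plane → ℝ) : ℝ × Plane × Plane → ℝ :=
  weakDeriv (slab T (Plane × Plane)) (0, basisVec i, 0) f

/-- `∂_{p_i} f` for `f = f(t,x,p)`. -/
def kinDp (T : ℝ) (i : Fin 2) (f : ℝ × Plane × Plane → ℝ) : ℝ × Plane × Plane → ℝ :=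
  weakDeriv (slab T (Plane × Plane)) (0, 0, basisVec i) f

/-- `∂_t u` for `u = u(t,x)` on `(0,T) × ℝ²`. -/
def fieldDt (T : ℝ) (u : ℝ × Plane → ℝ) : ℝ × Plane → ℝ :=
  weakDeriv (slab T Plane) (1, 0) u

/-- `∂_{x_i} u` for `u = u(t,x)`. -/
def fieldDx (T : ℝ) (i : Fin 2) (u : ℝ × Plane → ℝ) : ℝ × Plane → ℝ :=
  weakDeriv (slab T Plane) (0, basisVec i) u

/-! ### External currents -/

/-- `U` is continuous on `[0,T] × ℝ²`, differentiable in `x`, and its `x`-derivative is continuous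
on `[0,T] × ℝ²`. -/
structure IsControl (T : ℝ) (U : ℝ × Plane → Plane) : Prop where
  continuousOn : ContinuousOn U (Icc 0 T ×ˢ univ)
  differentiable : ∀ t ∈ Icc (0 : ℝ) T, Differentiable ℝ (fun x => U (t, x))
  continuousOn_fderiv :
    ContinuousOn (fun z : ℝ × Plane => fderiv ℝ (fun x => U (z.1, x)) z.2) (Icc 0 T ×ˢ univ)

/-- The classical divergence `div_x U (t,x)`. -/
def divX (U : ℝ × Plane → Plane) (t : ℝ) (x : Plane) : ℝ :=
  ∑ i : Fin 2, fderiv ℝ (fun y => U (t, y)) x (basisVec i) i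

/-! ### The controlled relativistic Vlasov-Maxwell system -/

/-- `(f,E,B)` solves the controlled Vlasov-Maxwell system on `[0,T]` with external current `U` and
initial data `(f₀,E₀,B₀)`; the differential equations hold pointwise almost everywhere. -/
structure IsSolution (T : ℝ) (U : ℝ × Plane → Plane)
    (f₀ : Plane × Plane → ℝ) (E₀ : Plane → Plane) (B₀ : Plane → ℝ)
    (f : ℝ × Plane × Plane → ℝ) (E : ℝ × Plane → Plane) (B : ℝ × Plane → ℝ) : Prop where
  vlasov : ∀ᵐ z ∂(volume.restrict (slab T (Plane × Plane))),
    kinDt T f z + ∑ i : Fin 2, vel z.2.2 i * kinDx T i f z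
      + ∑ i : Fin 2, (E (z.1, z.2.1) - B (z.1, z.2.1) • perp (vel z.2.2)) i * kinDp T i f z = 0
  ampere_one : ∀ᵐ z ∂(volume.restrict (slab T Plane)),
    fieldDt T (fun y => E y 0) z - fieldDx T 1 B z = - currentDensity f 0 z - U z 0
  ampere_two : ∀ᵐ z ∂(volume.restrict (slab T Plane)),
    fieldDt T (fun y => E y 1) z + fieldDx T 0 B z = - currentDensity f 1 z - U z 1
  faraday : ∀ᵐ z ∂(volume.restrict (slab T Plane)),
    fieldDt T B z + fieldDx T 0 (fun y => E y 1) z - fieldDx T 1 (fun y => E y 0) z = 0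
  gauss : ∀ᵐ z ∂(volume.restrict (slab T Plane)),
    fieldDx T 0 (fun y => E y 0) z + fieldDx T 1 (fun y => E y 1) z
      = chargeDensity f z - ∫ τ in (0 : ℝ)..z.1, divX U τ z.2
  initial_f : HasInitialValue T f f₀
  initial_E : ∀ i : Fin 2, HasInitialValue T (fun y => E y i) (fun x => E₀ x i)
  initial_B : HasInitialValue T B B₀

/-- The regularity class: `f`, `E`, `B` are of class `W^{1,∞} ∩ H¹`, and the (essential) support of
`f` is contained in `[0,T] × B_r × B_r` for some `r > 0`. -/
structure IsRegular (T : ℝ)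
    (f : ℝ × Plane × Plane → ℝ) (E : ℝ × Plane → Plane) (B : ℝ × Plane → ℝ) : Prop where
  f_lipschitz : MemW1 (slab T (Plane × Plane)) ∞ f
  f_energy : MemW1 (slab T (Plane × Plane)) 2 f
  E_lipschitz : ∀ i : Fin 2, MemW1 (slab T Plane) ∞ (fun y => E y i)
  E_energy : ∀ i : Fin 2, MemW1 (slab T Plane) 2 (fun y => E y i)
  B_lipschitz : MemW1 (slab T Plane) ∞ B
  B_energy : MemW1 (slab T Plane) 2 B
  support_f : ∃ r : ℝ, 0 < r ∧ ∀ᵐ z ∂(volume.restrict (slab T (Plane × Plane))),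
    f z ≠ 0 → ‖z.2.1‖ < r ∧ ‖z.2.2‖ < r

end

end VlasovMaxwell

/-! The proof is an $L^2$ energy estimate for the difference of two solutions, closed by Gronwall's
lemma. Put $d=f-\tilde f$, $e=E-\tilde E$, $b=B-\tilde B$ and $Q=|e|^2+b^2$; the external current
cancels in the equations for the differences.

Fields: the Maxwell equations give
$\frac12\partial_tQ=\partial_{x_2}(e_1b)-\partial_{x_1}(e_2b)-e\cdot(j_f-j_{\tilde f})$. The flux is
removed by spatial cutoffs. Since $d$ has bounded momentum support, Young's inequality bounds the
current term by a multiple of $Q+\int d^2\,dp$ (`field_energy`, `abs_mul_currentDensity_sub_le`).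

Density: subtracting the Vlasov equations, $d$ is transported by the force of $(E,B)$ with source
$-(e-\widehat p^\perp b)\cdot\partial_p\tilde f$. Because $\partial_p\tilde f$ is bounded,
multiplying by $2d$ makes the source at most a multiple of $d^2+|e|^2+b^2$, and compact support
keeps its $p$-integral finite (`vlasov_energy`).

Let $N(t)=\|d(t)\|^2+\|e(t)\|^2+\|b(t)\|^2$ in $L^2$. The initial condition makes $N$ continuous
with $N(0)=0$ (`HasInitialValue.exists_norm_sq_sub`), and the two estimates say that $N'\le CN$ in
the sense of distributions on $(0,T)$. A weak Gronwall lemma (`eq_zero_of_weak_gronwall`) yields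
$N=0$.

All derivatives are weak, so the products above rest on a product rule for bounded functions with
bounded weak derivatives (`HasWeakDeriv.mul`). Boundedness serves the product rule, and the $L^2$
bounds make the energies integrable. -/

namespace VlasovMaxwell

/-! ### Essentially bounded functions -/

section Bounded

variable {X : Type*} [MeasurableSpace X] {μ : Measure X}

theorem exists_ae_abs_le_of_memLp_top {u : X → ℝ} (hu : MemLp u ∞ μ) :
    ∃ C : ℝ, 0 ≤ C ∧ ∀ᵐ z ∂μ, |u z| ≤ C := by
  refine ⟨(eLpNormEssSup u μ).toReal, ENNReal.toReal_nonneg, ?_⟩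
  have hfin : eLpNormEssSup u μ < ⊤ := by
    have := hu.eLpNorm_lt_top
    rwa [eLpNorm_exponent_top] at this
  filter_upwards [ae_le_eLpNormEssSup (f := u) (μ := μ)] with z hz
  have := ENNReal.toReal_mono hfin.ne hz
  simpa using this

theorem memLp_top_mul {u w : X → ℝ} (hu : MemLp u ∞ μ) (hw : MemLp w ∞ μ) :
    MemLp (fun z => u z * w z) ∞ μ :=
  hw.mul' hu

theorem _root_.MeasureTheory.MemLp.fun_add {q : ℝ≥0∞} {u w : X → ℝ} (hu : MemLp u q μ)
    (hw : MemLp w q μ) : MemLp (fun z => u z + w z) q μ :=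
  hu.add hw

theorem _root_.MeasureTheory.Integrable.fun_sub {u w : X → ℝ} (hu : Integrable u μ)
    (hw : Integrable w μ) : Integrable (fun z => u z - w z) μ :=
  hu.sub hw

theorem integrable_mul_of_memLp_top {u φ : X → ℝ} (hu : MemLp u ∞ μ) (hφ : Integrable φ μ) :
    Integrable (fun z => u z * φ z) μ :=
  memLp_one_iff_integrable.1 ((memLp_one_iff_integrable.2 hφ).mul' hu)

end Bounded

/-! ### Calculus of weak derivatives -/

section WeakDerivCalculus

set_option linter.unusedSectionVars false

variable {V : Type*} [NormedAddCommGroup V] [NormedSpace ℝ V] [MeasureSpace V]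
  {Ω : Set V} {v : V} {u w g h : V → ℝ}

theorem hasCompactSupport_fderiv_apply {φ : V → ℝ} (hc : HasCompactSupport φ) (v : V) :
    HasCompactSupport (fun z => fderiv ℝ φ z v) :=
  hc.fderiv_apply (𝕜 := ℝ) v

theorem continuous_fderiv_apply_const {φ : V → ℝ} (hφ : ContDiff ℝ ∞ φ) (v : V) :
    Continuous (fun z => fderiv ℝ φ z v) :=
  (hφ.continuous_fderiv (by simp)).clm_apply continuous_const

theorem HasWeakDeriv.weakDeriv (hu : HasWeakDeriv Ω v u g) :
    HasWeakDeriv Ω v u (weakDeriv Ω v u) := by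
  have hex : ∃ g, HasWeakDeriv Ω v u g := ⟨g, hu⟩
  rw [VlasovMaxwell.weakDeriv, dif_pos hex]
  exact hex.choose_spec

variable [BorelSpace V] [FiniteDimensional ℝ V]

theorem MemW1.hasWeakDeriv {q : ℝ≥0∞} (hu : MemW1 Ω q u) (v : V) :
    HasWeakDeriv Ω v u (VlasovMaxwell.weakDeriv Ω v u) :=
  let ⟨_, hg, _⟩ := hu.2 v
  hg.weakDeriv

/-- The chosen derivative need not be the one supplied by the Sobolev class, but the two agree
almost everywhere by uniqueness. -/
theorem MemW1.memLp_weakDeriv {q : ℝ≥0∞} (hΩ : IsOpen Ω) (hu : MemW1 Ω q u) (v : V) :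
    MemLp (VlasovMaxwell.weakDeriv Ω v u) q (volume.restrict Ω) := by
  obtain ⟨g, hg, hgq⟩ := hu.2 v
  exact (memLp_congr_ae (hg.ae_eq hΩ hg.weakDeriv)).1 hgq

variable [(volume : Measure V).IsAddHaarMeasure]

theorem locallyIntegrableOn_of_memLp_top (hu : MemLp u ∞ (volume.restrict Ω)) :
    LocallyIntegrableOn u Ω := by
  exact locallyIntegrableOn_of_locallyIntegrable_restrict (hu.locallyIntegrable le_top)

theorem integrable_mul_test {φ : V → ℝ} (hu : MemLp u ∞ (volume.restrict Ω))
    (hφ : Continuous φ) (hc : HasCompactSupport φ) :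
    Integrable (fun z => u z * φ z) (volume.restrict Ω) :=
  integrable_mul_of_memLp_top hu (hφ.integrable_of_hasCompactSupport hc)

theorem HasWeakDeriv.sub (hu : HasWeakDeriv Ω v u g) (hw : HasWeakDeriv Ω v w h)
    (hub : MemLp u ∞ (volume.restrict Ω)) (hgb : MemLp g ∞ (volume.restrict Ω))
    (hwb : MemLp w ∞ (volume.restrict Ω)) (hhb : MemLp h ∞ (volume.restrict Ω)) :
    HasWeakDeriv Ω v (fun z => u z - w z) (fun z => g z - h z) where
  locallyIntegrableOn := hu.locallyIntegrableOn.sub hw.locallyIntegrableOn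
  locallyIntegrableOn_deriv := hu.locallyIntegrableOn_deriv.sub hw.locallyIntegrableOn_deriv
  integral_eq φ hφ hc hs := by
    have c1 := continuous_fderiv_apply_const hφ v
    have c2 := hasCompactSupport_fderiv_apply hc v
    simp only [sub_mul]
    rw [integral_sub (integrable_mul_test hub c1 c2) (integrable_mul_test hwb c1 c2),
      integral_sub (integrable_mul_test hgb hφ.continuous hc)
        (integrable_mul_test hhb hφ.continuous hc),
      hu.integral_eq φ hφ hc hs, hw.integral_eq φ hφ hc hs]
    ring

open scoped Convolution in
theorem abs_convolution_normed_le {w : V → ℝ} {C : ℝ}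
    (hC : ∀ᵐ z, |w z| ≤ C) (ρ : ContDiffBump (0 : V)) (z : V) :
    |(ρ.normed volume ⋆[ContinuousLinearMap.lsmul ℝ ℝ, volume] w) z| ≤ C := by
  rw [convolution_eq_swap, ← Real.norm_eq_abs]
  have hint : Integrable (fun t => ρ.normed volume (z - t) * C) :=
    (ρ.integrable_normed.comp_sub_left z).mul_const C
  refine (norm_integral_le_of_norm_le hint ?_).trans_eq ?_
  · filter_upwards [hC] with t ht
    simp only [ContinuousLinearMap.lsmul_apply, smul_eq_mul, norm_mul, Real.norm_eq_abs]
    rw [abs_of_nonneg (ρ.nonneg_normed _)]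
    exact mul_le_mul_of_nonneg_left ht (ρ.nonneg_normed _)
  · rw [integral_mul_const, integral_sub_left_eq_self, ρ.integral_normed, one_mul]

-- The derivative falls on the kernel, and $y\mapsto\rho(z-y)$ is an admissible test function as
-- soon as the closed ball about $z$ lies in $\Omega$. The sign from the reflection $y\mapsto z-y$
-- cancels the sign in the definition of the weak derivative. Extension by zero outside $\Omega$ is
-- harmless at such points.
open scoped Convolution in
theorem HasWeakDeriv.fderiv_convolution (hΩ : IsOpen Ω) (hw : HasWeakDeriv Ω v w h)
    (hwb : MemLp w ∞ (volume.restrict Ω)) (ρ : ContDiffBump (0 : V)) {z : V}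
    (hz : Metric.closedBall z ρ.rOut ⊆ Ω) :
    fderiv ℝ (ρ.normed volume ⋆[ContinuousLinearMap.lsmul ℝ ℝ, volume] (Ω.indicator w)) z v =
      (ρ.normed volume ⋆[ContinuousLinearMap.lsmul ℝ ℝ, volume] (Ω.indicator h)) z := by
  have hρ : ContDiff ℝ ∞ (ρ.normed (volume : Measure V)) := ρ.contDiff_normed
  have hw0 : LocallyIntegrable (Ω.indicator w) volume :=
    ((memLp_indicator_iff_restrict hΩ.measurableSet).2 hwb).locallyIntegrable le_top
  have hd := ρ.hasCompactSupport_normed (μ := volume).hasFDerivAt_convolution_left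
    (ContinuousLinearMap.lsmul ℝ ℝ) (hρ.of_le (by simp)) hw0 z
  rw [hd.fderiv]
  set φ : V → ℝ := fun y => ρ.normed volume (z - y) with hφdef
  have hφ : ContDiff ℝ ∞ φ := hρ.comp (contDiff_const.sub contDiff_id)
  have hsub : tsupport φ ⊆ Metric.closedBall z ρ.rOut := by
    refine closure_minimal ?_ Metric.isClosed_closedBall
    intro y hy
    have : z - y ∈ tsupport (ρ.normed volume) := subset_tsupport _ hy
    rw [ρ.tsupport_normed_eq] at this
    rw [Metric.mem_closedBall, dist_comm, dist_eq_norm]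
    simpa using this
  have hc : HasCompactSupport φ :=
    (isCompact_closedBall z ρ.rOut).of_isClosed_subset (isClosed_tsupport _) hsub
  have hfd : ∀ y, fderiv ℝ φ y v = - fderiv ℝ (ρ.normed volume) (z - y) v := by
    intro y
    have h1 : HasFDerivAt (fun y : V => z - y) (-(ContinuousLinearMap.id ℝ V)) y :=
      (hasFDerivAt_id y).const_sub z
    have h2 := ((hρ.differentiable (by simp)) (z - y)).hasFDerivAt.comp y h1
    have h3 : fderiv ℝ φ y = _ := h2.fderiv
    rw [h3]
    simp
  have key := hw.integral_eq φ hφ hc (hsub.trans hz)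
  have hint : ConvolutionExistsAt (fderiv ℝ (ρ.normed volume)) (Ω.indicator w) z
      ((ContinuousLinearMap.lsmul ℝ ℝ).precompL V) volume :=
    (ρ.hasCompactSupport_normed.fderiv (𝕜 := ℝ)).convolutionExists_left _
      (hρ.continuous_fderiv (by simp)) hw0 z
  rw [convolution_eq_swap, convolution_eq_swap, ContinuousLinearMap.integral_apply]
  · have e1 : ∀ y, ((ContinuousLinearMap.lsmul ℝ ℝ).precompL V
        (fderiv ℝ (ρ.normed volume) (z - y)) (Ω.indicator w y)) v =
        Ω.indicator (fun y => - (w y * fderiv ℝ φ y v)) y := by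
      intro y
      by_cases hy : y ∈ Ω <;> simp [hy, hfd, mul_comm]
    have e2 : ∀ y, ContinuousLinearMap.lsmul ℝ ℝ (ρ.normed volume (z - y)) (Ω.indicator h y) =
        Ω.indicator (fun y => h y * φ y) y := by
      intro y
      by_cases hy : y ∈ Ω <;> simp [hy, hφdef, mul_comm]
    simp_rw [e1, e2]
    rw [integral_indicator hΩ.measurableSet, integral_indicator hΩ.measurableSet, integral_neg,
      key, neg_neg]
  · exact hint.integrable_swap

/-- Product rule with one smooth factor: $W\varphi$ is itself a test function. -/
theorem HasWeakDeriv.mul_contDiff (hu : HasWeakDeriv Ω v u g)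
    (hub : MemLp u ∞ (volume.restrict Ω)) (hgb : MemLp g ∞ (volume.restrict Ω))
    {W φ : V → ℝ} (hW : ContDiff ℝ ∞ W) (hφ : ContDiff ℝ ∞ φ) (hc : HasCompactSupport φ)
    (hs : tsupport φ ⊆ Ω) :
    ∫ z in Ω, u z * (W z * fderiv ℝ φ z v) =
      - ∫ z in Ω, (g z * (W z * φ z) + u z * (fderiv ℝ W z v * φ z)) := by
  have hWφ : HasCompactSupport (fun z => W z * φ z) := hc.mul_left
  have key := hu.integral_eq (fun z => W z * φ z) (hW.mul hφ) hWφ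
    ((tsupport_mul_subset_right (f := W) (g := φ)).trans hs)
  have hfd : ∀ z, fderiv ℝ (fun z => W z * φ z) z v =
      W z * fderiv ℝ φ z v + fderiv ℝ W z v * φ z := by
    intro z
    rw [fderiv_fun_mul (hW.differentiable (by simp) z) (hφ.differentiable (by simp) z)]
    simp [mul_comm]
  simp_rw [hfd, mul_add] at key
  have i1 : Integrable (fun z => u z * (W z * fderiv ℝ φ z v)) (volume.restrict Ω) :=
    integrable_mul_test hub (hW.continuous.mul (continuous_fderiv_apply_const hφ v))
      (hasCompactSupport_fderiv_apply hc v).mul_left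
  have i2 : Integrable (fun z => u z * (fderiv ℝ W z v * φ z)) (volume.restrict Ω) :=
    integrable_mul_test hub ((continuous_fderiv_apply_const hW v).mul hφ.continuous) hc.mul_left
  have i3 : Integrable (fun z => g z * (W z * φ z)) (volume.restrict Ω) :=
    integrable_mul_test hgb (hW.continuous.mul hφ.continuous) hWφ
  rw [integral_add i1 i2] at key
  rw [integral_add i3 i2]
  linarith

-- Mollify one factor, apply the smooth case, and pass to the limit by dominated convergence. The
-- mollified functions converge only almost everywhere, but they are bounded by the essential bounds
-- of $w$ and $h$.
open scoped Convolution in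
theorem HasWeakDeriv.mul (hΩ : IsOpen Ω)
    (hu : HasWeakDeriv Ω v u g) (hw : HasWeakDeriv Ω v w h)
    (hub : MemLp u ∞ (volume.restrict Ω)) (hgb : MemLp g ∞ (volume.restrict Ω))
    (hwb : MemLp w ∞ (volume.restrict Ω)) (hhb : MemLp h ∞ (volume.restrict Ω)) :
    HasWeakDeriv Ω v (fun z => u z * w z) (fun z => g z * w z + u z * h z) where
  locallyIntegrableOn := locallyIntegrableOn_of_memLp_top (memLp_top_mul hub hwb)
  locallyIntegrableOn_deriv := locallyIntegrableOn_of_memLp_top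
    ((memLp_top_mul hgb hwb).add (memLp_top_mul hub hhb))
  integral_eq φ hφ hc hs := by
    -- Mollification radii at most $\delta$ keep every ball centred on the support of $\varphi$
    -- inside $\Omega$, where mollification commutes with the derivative.
    obtain ⟨δ, hδ, hδΩ⟩ := IsCompact.exists_cthickening_subset_open hc hΩ hs
    let ρ : ℕ → ContDiffBump (0 : V) := fun n =>
      ⟨δ / (n + 2) / 2, δ / (n + 2), by positivity, half_lt_self (by positivity)⟩
    have hρ0 : Tendsto (fun n => (ρ n).rOut) atTop (𝓝 0) := by
      have := (tendsto_const_div_atTop_nhds_zero_nat δ).comp (tendsto_add_atTop_nat 2)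
      refine this.congr fun n => ?_
      simp [ρ]
    have hρδ : ∀ n, (ρ n).rOut ≤ δ := fun n => by
      show δ / ((n : ℝ) + 2) ≤ δ
      exact div_le_self hδ.le (by linarith [n.cast_nonneg (α := ℝ)])
    -- A bounded ratio of the radii is what the almost everywhere convergence of mollifications of a
    -- merely locally integrable function requires.
    have hρK : ∀ᶠ n in atTop, (ρ n).rOut ≤ 2 * (ρ n).rIn :=
      Eventually.of_forall fun n => by
        show δ / ((n : ℝ) + 2) ≤ 2 * (δ / ((n : ℝ) + 2) / 2)
        linarith
    have hw0 := (memLp_indicator_iff_restrict hΩ.measurableSet).2 hwb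
    have hh0 := (memLp_indicator_iff_restrict hΩ.measurableSet).2 hhb
    set W : ℕ → V → ℝ := fun n =>
      (ρ n).normed volume ⋆[ContinuousLinearMap.lsmul ℝ ℝ, volume] (Ω.indicator w) with hWdef
    set H : ℕ → V → ℝ := fun n =>
      (ρ n).normed volume ⋆[ContinuousLinearMap.lsmul ℝ ℝ, volume] (Ω.indicator h) with hHdef
    have hWs : ∀ n, ContDiff ℝ ∞ (W n) := fun n =>
      (ρ n).hasCompactSupport_normed.contDiff_convolution_left _ (ρ n).contDiff_normed
        (hw0.locallyIntegrable le_top)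
    have hHs : ∀ n, ContDiff ℝ ∞ (H n) := fun n =>
      (ρ n).hasCompactSupport_normed.contDiff_convolution_left _ (ρ n).contDiff_normed
        (hh0.locallyIntegrable le_top)
    have hWlim := ContDiffBump.ae_convolution_tendsto_right_of_locallyIntegrable hρ0 hρK
      (hw0.locallyIntegrable le_top)
    have hHlim := ContDiffBump.ae_convolution_tendsto_right_of_locallyIntegrable hρ0 hρK
      (hh0.locallyIntegrable le_top)
    have hder : ∀ n, ∀ z, fderiv ℝ (W n) z v * φ z = H n z * φ z := by
      intro n z
      by_cases hz : z ∈ tsupport φ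
      · rw [hw.fderiv_convolution hΩ hwb (ρ n)]
        exact ((Metric.closedBall_subset_closedBall (hρδ n)).trans
          (Metric.closedBall_subset_cthickening hz δ)).trans hδΩ
      · simp [image_eq_zero_of_notMem_tsupport hz]
    have heq : ∀ n, ∫ z in Ω, u z * (W n z * fderiv ℝ φ z v) =
        - ∫ z in Ω, (g z * (W n z * φ z) + u z * (H n z * φ z)) := by
      intro n
      rw [hu.mul_contDiff hub hgb (hWs n) hφ hc hs]
      simp_rw [hder]
    obtain ⟨Cw, -, hCw⟩ := exists_ae_abs_le_of_memLp_top hw0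
    obtain ⟨Ch, -, hCh⟩ := exists_ae_abs_le_of_memLp_top hh0
    have hWb : ∀ n z, |W n z| ≤ Cw := fun n z => abs_convolution_normed_le hCw (ρ n) z
    have hHb : ∀ n z, |H n z| ≤ Ch := fun n z => abs_convolution_normed_le hCh (ρ n) z
    have cφ := hφ.continuous
    have cφ' := continuous_fderiv_apply_const hφ v
    have sφ' := hasCompactSupport_fderiv_apply hc v
    have L1 : Tendsto (fun n => ∫ z in Ω, u z * (W n z * fderiv ℝ φ z v)) atTop
        (𝓝 (∫ z in Ω, u z * w z * fderiv ℝ φ z v)) := by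
      refine tendsto_integral_of_dominated_convergence
        (fun z => Cw * ‖u z * fderiv ℝ φ z v‖) (fun n => ?_)
        ((integrable_mul_test hub cφ' sφ').norm.const_mul Cw) (fun n => ?_) ?_
      · exact (integrable_mul_test hub ((hWs n).continuous.mul cφ') sφ'.mul_left).1
      · refine Eventually.of_forall fun z => ?_
        rw [show u z * (W n z * fderiv ℝ φ z v) = W n z * (u z * fderiv ℝ φ z v) by ring, norm_mul]
        exact mul_le_mul_of_nonneg_right (hWb n z) (norm_nonneg _)
      · rw [ae_restrict_iff' hΩ.measurableSet]
        filter_upwards [hWlim] with z hz hzΩ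
        rw [indicator_of_mem hzΩ] at hz
        rw [mul_assoc]
        exact (hz.mul_const _).const_mul _
    have L2 : Tendsto (fun n => ∫ z in Ω, (g z * (W n z * φ z) + u z * (H n z * φ z))) atTop
        (𝓝 (∫ z in Ω, (g z * w z + u z * h z) * φ z)) := by
      refine tendsto_integral_of_dominated_convergence
        (fun z => Cw * ‖g z * φ z‖ + Ch * ‖u z * φ z‖) (fun n => ?_)
        (((integrable_mul_test hgb cφ hc).norm.const_mul Cw).add
          ((integrable_mul_test hub cφ hc).norm.const_mul Ch)) (fun n => ?_) ?_
      · exact ((integrable_mul_test hgb ((hWs n).continuous.mul cφ) hc.mul_left).add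
          (integrable_mul_test hub ((hHs n).continuous.mul cφ) hc.mul_left)).1
      · refine Eventually.of_forall fun z => (norm_add_le _ _).trans (add_le_add ?_ ?_)
        · rw [show g z * (W n z * φ z) = W n z * (g z * φ z) by ring, norm_mul]
          exact mul_le_mul_of_nonneg_right (hWb n z) (norm_nonneg _)
        · rw [show u z * (H n z * φ z) = H n z * (u z * φ z) by ring, norm_mul]
          exact mul_le_mul_of_nonneg_right (hHb n z) (norm_nonneg _)
      · rw [ae_restrict_iff' hΩ.measurableSet]
        filter_upwards [hWlim, hHlim] with z hz hz' hzΩ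
        rw [indicator_of_mem hzΩ] at hz hz'
        rw [add_mul, mul_assoc, mul_assoc]
        exact ((hz.mul_const _).const_mul _).add ((hz'.mul_const _).const_mul _)
    exact tendsto_nhds_unique L1 (L2.neg.congr fun n => (heq n).symm)

end WeakDerivCalculus

/-! ### Weak differential inequalities on an interval -/

/-- Nonnegative test functions of class `C_c^∞(0,T)`. -/
structure IsTimeTest (T : ℝ) (ψ : ℝ → ℝ) : Prop where
  contDiff : ContDiff ℝ ∞ ψ
  hasCompactSupport : HasCompactSupport ψ
  tsupport_subset : tsupport ψ ⊆ Ioo 0 T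
  nonneg : ∀ t, 0 ≤ ψ t

section TimeTest

variable {T : ℝ} {ψ : ℝ → ℝ}

theorem IsTimeTest.continuous_deriv (h : IsTimeTest T ψ) : Continuous (deriv ψ) :=
  h.contDiff.continuous_deriv (by simp)

theorem IsTimeTest.hasDerivAt (h : IsTimeTest T ψ) (t : ℝ) : HasDerivAt ψ (deriv ψ t) t :=
  (h.contDiff.differentiable (by simp) t).hasDerivAt

theorem IsTimeTest.eq_zero (h : IsTimeTest T ψ) {t : ℝ} (ht : t ∉ Ioo 0 T) : ψ t = 0 :=
  image_eq_zero_of_notMem_tsupport fun h0 => ht (h.tsupport_subset h0)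

theorem IsTimeTest.deriv_eq_zero (h : IsTimeTest T ψ) {t : ℝ} (ht : t ∉ Ioo 0 T) :
    deriv ψ t = 0 :=
  image_eq_zero_of_notMem_tsupport fun h0 =>
    ht (h.tsupport_subset (tsupport_deriv_subset h0))

theorem IsTimeTest.exists_abs_le (h : IsTimeTest T ψ) :
    ∃ C, ∀ t, |ψ t| ≤ C ∧ |deriv ψ t| ≤ C := by
  obtain ⟨C, hC⟩ := h.contDiff.continuous.bounded_above_of_compact_support h.hasCompactSupport
  obtain ⟨C', hC'⟩ := h.continuous_deriv.bounded_above_of_compact_support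
    h.hasCompactSupport.deriv
  exact ⟨max C C', fun t => ⟨(hC t).trans (le_max_left _ _), (hC' t).trans (le_max_right _ _)⟩⟩

-- Test with a mollified indicator of $[s,t]$: its derivative is $k(s-\cdot)-k(t-\cdot)$, so the
-- hypothesis reads $(k*Y)(t)\le(k*Y)(s)$. Then let the kernel concentrate.
open scoped Convolution in
theorem le_of_weak_deriv_nonpos {Y : ℝ → ℝ} (hY : Continuous Y)
    (h : ∀ ψ, IsTimeTest T ψ → 0 ≤ ∫ t, Y t * deriv ψ t) {s t : ℝ} (hs : 0 < s) (hst : s ≤ t)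
    (ht : t < T) : Y t ≤ Y s := by
  set δ := min s (T - t) with hδdef
  have hδ : 0 < δ := lt_min hs (by linarith)
  -- The shift by 2 makes the outer radius strictly less than $\delta$ already at $n=0$, so the test
  -- function is supported inside the open interval.
  let ρ : ℕ → ContDiffBump (0 : ℝ) := fun n =>
    ⟨δ / (n + 2) / 2, δ / (n + 2), by positivity, half_lt_self (by positivity)⟩
  have hρ0 : Tendsto (fun n => (ρ n).rOut) atTop (𝓝 0) := by
    have := (tendsto_const_div_atTop_nhds_zero_nat δ).comp (tendsto_add_atTop_nat 2)
    refine this.congr fun n => ?_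
    simp [ρ]
  have hlim := fun x => ContDiffBump.convolution_tendsto_right_of_continuous (μ := volume)
    hρ0 hY x
  refine le_of_tendsto_of_tendsto' (hlim t) (hlim s) fun n => ?_
  have hρδ : (ρ n).rOut < δ := by
    show δ / ((n : ℝ) + 2) < δ
    exact div_lt_self hδ (by linarith [n.cast_nonneg (α := ℝ)])
  set k : ℝ → ℝ := (ρ n).normed volume with hk
  have hks : ContDiff ℝ ∞ k := (ρ n).contDiff_normed
  have hkc : Continuous k := hks.continuous
  have hk0 : ∀ x, 0 ≤ k x := (ρ n).nonneg_normed
  set P : ℝ → ℝ := fun x => ∫ y in (0 : ℝ)..x, k y with hP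
  have hPd : ∀ x, HasDerivAt P (k x) x := fun x =>
    intervalIntegral.integral_hasDerivAt_right (hkc.intervalIntegrable _ _)
      (hkc.stronglyMeasurableAtFilter _ _) hkc.continuousAt
  have hPs : ContDiff ℝ ∞ P := by
    rw [contDiff_infty_iff_deriv]
    refine ⟨fun x => (hPd x).differentiableAt, ?_⟩
    have : deriv P = k := funext fun x => (hPd x).deriv
    rwa [this]
  set ψ : ℝ → ℝ := fun τ => P (t - τ) - P (s - τ) with hψ
  have hψd : ∀ τ, HasDerivAt ψ (k (s - τ) - k (t - τ)) τ := fun τ => by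
    have h1 := (hPd (t - τ)).comp τ ((hasDerivAt_id τ).const_sub t)
    have h2 := (hPd (s - τ)).comp τ ((hasDerivAt_id τ).const_sub s)
    convert! h1.sub h2 using 1
    ring
  have hψeq : ∀ τ, ψ τ = ∫ y in (s - τ)..(t - τ), k y := fun τ =>
    intervalIntegral.integral_interval_sub_left (hkc.intervalIntegrable _ _)
      (hkc.intervalIntegrable _ _)
  have hsupp : tsupport ψ ⊆ Icc (s - (ρ n).rOut) (t + (ρ n).rOut) := by
    refine closure_minimal (fun τ hτ => ?_) isClosed_Icc
    by_contra hcon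
    refine hτ ?_
    show ψ τ = 0
    rw [hψeq]
    have hz : ∀ y ∈ uIcc (s - τ) (t - τ), k y = 0 := by
      intro y hy
      rw [uIcc_of_le (by linarith)] at hy
      apply image_eq_zero_of_notMem_tsupport
      rw [(ρ n).tsupport_normed_eq, Metric.mem_closedBall, dist_zero_right, Real.norm_eq_abs]
      intro habs
      have := abs_le.1 habs
      exact hcon ⟨by linarith [hy.2, hy.1], by linarith [hy.1, hy.2]⟩
    rw [intervalIntegral.integral_congr (g := fun _ => 0) hz]
    simp
  have htest : IsTimeTest T ψ :=
    { contDiff := (hPs.comp (contDiff_const.sub contDiff_id)).sub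
        (hPs.comp (contDiff_const.sub contDiff_id))
      hasCompactSupport := isCompact_Icc.of_isClosed_subset (isClosed_tsupport _) hsupp
      tsupport_subset := hsupp.trans (Icc_subset_Ioo
        (by linarith [min_le_left s (T - t)]) (by linarith [min_le_right s (T - t)]))
      nonneg := fun τ => by
        rw [hψeq]
        exact intervalIntegral.integral_nonneg (by linarith) fun y _ => hk0 y }
  have key := h ψ htest
  have hint : ∀ x, Integrable (fun τ => k (x - τ) * Y τ) := fun x => by
    refine Continuous.integrable_of_hasCompactSupport (by fun_prop) ?_
    have : HasCompactSupport (fun τ => k (x - τ)) :=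
      (ρ n).hasCompactSupport_normed.comp_homeomorph (Homeomorph.subLeft x)
    exact this.mul_right
  have hconv : ∀ x, (k ⋆[ContinuousLinearMap.lsmul ℝ ℝ, volume] Y) x = ∫ τ, k (x - τ) * Y τ := by
    intro x
    rw [convolution_eq_swap]
    simp
  rw [hconv, hconv]
  have e : ∀ τ, Y τ * deriv ψ τ = k (s - τ) * Y τ - k (t - τ) * Y τ := fun τ => by
    rw [(hψd τ).deriv]; ring
  simp_rw [e] at key
  rw [integral_sub (hint s) (hint t)] at key
  linarith

/-- The function $N-C\int_0^tN$ has nonpositive distributional derivative, hence is nonincreasing.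
Since it vanishes at $0$, $N\le C\int_0^tN$, and the classical Gronwall inequality applies to the
primitive. -/
theorem eq_zero_of_weak_gronwall {N : ℝ → ℝ} {C : ℝ} (hN : ContinuousOn N (Icc 0 T))
    (hN0 : N 0 = 0) (hNn : ∀ t, 0 ≤ N t)
    (h : ∀ ψ, IsTimeTest T ψ →
      - ∫ t in Ioo 0 T, N t * deriv ψ t ≤ C * ∫ t in Ioo 0 T, N t * ψ t)
    {t : ℝ} (ht : t ∈ Ioo 0 T) : N t = 0 := by
  have hT : (0 : ℝ) ≤ T := (ht.1.trans ht.2).le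
  set M : ℝ → ℝ := IccExtend hT ((Icc 0 T).domRestrict N) with hM
  have hMc : Continuous M := (continuousOn_iff_continuous_domRestrict.1 hN).Icc_extend'
  have hMN : ∀ t ∈ Icc 0 T, M t = N t := fun t ht => IccExtend_of_mem hT _ ht
  have hMn : ∀ t, 0 ≤ M t := fun t => hNn _
  have hset : ∀ η : ℝ → ℝ, (∀ t, t ∉ Ioo 0 T → η t = 0) →
      ∫ t in Ioo 0 T, N t * η t = ∫ t, M t * η t := by
    intro η hη
    have e : ∫ t in Ioo 0 T, M t * η t = ∫ t, M t * η t :=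
      setIntegral_eq_integral_of_forall_compl_eq_zero fun t ht => by rw [hη t ht, mul_zero]
    rw [← e]
    refine setIntegral_congr_fun measurableSet_Ioo fun t ht => ?_
    show N t * η t = M t * η t
    rw [hMN t (Ioo_subset_Icc_self ht)]
  set G : ℝ → ℝ := fun x => ∫ y in (0 : ℝ)..x, M y with hG
  have hGd : ∀ x, HasDerivAt G (M x) x := fun x =>
    intervalIntegral.integral_hasDerivAt_right (hMc.intervalIntegrable _ _)
      (hMc.stronglyMeasurableAtFilter _ _) hMc.continuousAt
  have hGc : Continuous G := continuous_iff_continuousAt.2 fun x => (hGd x).continuousAt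
  have hYc : Continuous fun t => M t - C * G t := hMc.sub (continuous_const.mul hGc)
  have hY : ∀ ψ, IsTimeTest T ψ → 0 ≤ ∫ t, (M t - C * G t) * deriv ψ t := by
    intro ψ hψ
    have h1 := h ψ hψ
    rw [hset _ fun t => hψ.deriv_eq_zero, hset _ fun t => hψ.eq_zero] at h1
    have i1 : ∀ F : ℝ → ℝ, Continuous F → Integrable (fun t => F t * deriv ψ t) := fun F hF =>
      (hF.mul hψ.continuous_deriv).integrable_of_hasCompactSupport
        hψ.hasCompactSupport.deriv.mul_left
    have i2 : ∀ F : ℝ → ℝ, Continuous F → Integrable (fun t => F t * ψ t) := fun F hF =>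
      (hF.mul hψ.contDiff.continuous).integrable_of_hasCompactSupport
        hψ.hasCompactSupport.mul_left
    have hparts : ∫ t, G t * deriv ψ t = - ∫ t, M t * ψ t :=
      integral_mul_deriv_eq_deriv_mul_of_integrable (fun x _ => hGd x) (fun x _ => hψ.hasDerivAt x)
        (i1 G hGc) (i2 M hMc) (i2 G hGc)
    simp_rw [sub_mul, mul_assoc]
    rw [integral_sub (i1 M hMc) ((i1 G hGc).const_mul C), integral_const_mul, hparts]
    linarith
  have hM0 : M 0 = 0 := by rw [hMN 0 ⟨le_rfl, hT⟩, hN0]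
  have hG0 : G 0 = 0 := by simp [hG]
  have hle : ∀ τ ∈ Ioo 0 T, M τ ≤ C * G τ := by
    intro τ hτ
    have hlim : Tendsto (fun s => M s - C * G s) (𝓝[>] 0) (𝓝 (M 0 - C * G 0)) :=
      hYc.continuousAt.tendsto.mono_left nhdsWithin_le_nhds
    -- Monotonicity is known only on the open interval; the left endpoint is reached by continuity.
    have : M τ - C * G τ ≤ M 0 - C * G 0 := by
      refine ge_of_tendsto hlim ?_
      filter_upwards [Ioc_mem_nhdsGT hτ.1] with s hs
      exact le_of_weak_deriv_nonpos hYc hY hs.1 hs.2 hτ.2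
    rw [hM0, hG0] at this
    linarith
  have hGt : ‖G t‖ ≤ gronwallBound 0 C 0 (t - 0) := by
    refine norm_le_gronwallBound_of_norm_deriv_right_le (f := G) (f' := M) (b := t)
      hGc.continuousOn (fun x _ => (hGd x).hasDerivWithinAt) (by simp [hG0]) ?_ t ⟨ht.1.le, le_rfl⟩
    intro x hx
    have hGn : 0 ≤ G x := intervalIntegral.integral_nonneg hx.1 fun y _ => hMn y
    rw [Real.norm_of_nonneg (hMn x), Real.norm_of_nonneg hGn, add_zero]
    rcases hx.1.eq_or_lt with h0 | h0
    · rw [← h0, hM0, hG0, mul_zero]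
    · exact hle x ⟨h0, hx.2.trans ht.2⟩
  rw [gronwallBound_ε0_δ0] at hGt
  have hG_zero : G t = 0 := norm_le_zero_iff.1 hGt
  have := hle t ht
  rw [hG_zero, mul_zero, hMN t (Ioo_subset_Icc_self ht)] at this
  exact le_antisymm this (hNn t)

end TimeTest

/-! ### Test functions on the slab -/

section Slab

set_option linter.unusedSectionVars false

variable {Y : Type*} [NormedAddCommGroup Y] [NormedSpace ℝ Y] [MeasureSpace Y]
  {T : ℝ} {ψ : ℝ → ℝ} {κ : Y → ℝ} {q g Q : ℝ × Y → ℝ}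

theorem isOpen_slab (T : ℝ) : IsOpen (slab T Y) := isOpen_Ioo.prod isOpen_univ

theorem contDiff_tensor (hψ : IsTimeTest T ψ) (hκ : ContDiff ℝ ∞ κ) :
    ContDiff ℝ ∞ (fun z : ℝ × Y => ψ z.1 * κ z.2) :=
  (hψ.contDiff.comp contDiff_fst).mul (hκ.comp contDiff_snd)

theorem tsupport_tensor_subset :
    tsupport (fun z : ℝ × Y => ψ z.1 * κ z.2) ⊆ tsupport ψ ×ˢ tsupport κ := by
  refine closure_minimal (fun z hz => ?_) ((isClosed_tsupport _).prod (isClosed_tsupport _))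
  have hz' : ψ z.1 * κ z.2 ≠ 0 := hz
  exact ⟨subset_tsupport _ (left_ne_zero_of_mul hz'), subset_tsupport _ (right_ne_zero_of_mul hz')⟩

theorem hasCompactSupport_tensor (hψ : HasCompactSupport ψ) (hκ : HasCompactSupport κ) :
    HasCompactSupport (fun z : ℝ × Y => ψ z.1 * κ z.2) :=
  (hψ.prod hκ).of_isClosed_subset (isClosed_tsupport _) tsupport_tensor_subset

theorem fderiv_tensor (hψ : IsTimeTest T ψ) (hκ : ContDiff ℝ ∞ κ) (z : ℝ × Y) (a : ℝ) (b : Y) :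
    fderiv ℝ (fun z : ℝ × Y => ψ z.1 * κ z.2) z (a, b) =
      a * deriv ψ z.1 * κ z.2 + ψ z.1 * fderiv ℝ κ z.2 b := by
  have h1 : HasFDerivAt (fun z : ℝ × Y => ψ z.1) _ z :=
    (hψ.hasDerivAt z.1).hasFDerivAt.comp z hasFDerivAt_fst
  have h2 : HasFDerivAt (fun z : ℝ × Y => κ z.2) _ z :=
    (hκ.differentiable (by simp) z.2).hasFDerivAt.comp z hasFDerivAt_snd
  have h3 : fderiv ℝ (fun z : ℝ × Y => ψ z.1 * κ z.2) z = _ := (h1.mul h2).fderiv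
  rw [h3]
  simp
  ring

theorem HasWeakDeriv.integral_time (hq : HasWeakDeriv (slab T Y) (1, 0) q g)
    (hψ : IsTimeTest T ψ) (hκ : ContDiff ℝ ∞ κ) (hκc : HasCompactSupport κ) :
    ∫ z in slab T Y, q z * (deriv ψ z.1 * κ z.2) = - ∫ z in slab T Y, g z * (ψ z.1 * κ z.2) := by
  have := hq.integral_eq _ (contDiff_tensor hψ hκ)
    (hasCompactSupport_tensor hψ.hasCompactSupport hκc)
    (tsupport_tensor_subset.trans (prod_mono hψ.tsupport_subset (subset_univ _)))
  simpa [fderiv_tensor hψ hκ] using this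

theorem HasWeakDeriv.integral_space {b : Y} (hq : HasWeakDeriv (slab T Y) (0, b) q g)
    (hψ : IsTimeTest T ψ) (hκ : ContDiff ℝ ∞ κ) (hκc : HasCompactSupport κ) :
    ∫ z in slab T Y, q z * (ψ z.1 * fderiv ℝ κ z.2 b) =
      - ∫ z in slab T Y, g z * (ψ z.1 * κ z.2) := by
  have := hq.integral_eq _ (contDiff_tensor hψ hκ)
    (hasCompactSupport_tensor hψ.hasCompactSupport hκc)
    (tsupport_tensor_subset.trans (prod_mono hψ.tsupport_subset (subset_univ _)))
  simpa [fderiv_tensor hψ hκ] using this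

variable [BorelSpace Y] [FiniteDimensional ℝ Y] [(volume : Measure Y).IsAddHaarMeasure]

instance : (volume : Measure (ℝ × Y)).IsAddHaarMeasure :=
  Measure.prod.instIsAddHaarMeasure volume volume

theorem integrable_indicator_closedBall (r : ℝ) :
    Integrable ((Metric.closedBall (0 : Y) r).indicator fun _ => (1 : ℝ)) :=
  (integrable_indicator_iff measurableSet_closedBall).2
    (integrableOn_const (measure_closedBall_lt_top.ne))

theorem volume_restrict_slab (T : ℝ) :
    (volume : Measure (ℝ × Y)).restrict (slab T Y) =
      ((volume : Measure ℝ).restrict (Ioo 0 T)).prod (volume : Measure Y) := by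
  rw [slab, Measure.volume_eq_prod, ← Measure.prod_restrict, Measure.restrict_univ]

theorem integrable_mul_time {Q : ℝ × Y → ℝ} (hQ : Integrable Q (volume.restrict (slab T Y)))
    {η : ℝ → ℝ} (hη : Continuous η) {C : ℝ} (hC : ∀ t, |η t| ≤ C) :
    Integrable (fun z => Q z * η z.1) (volume.restrict (slab T Y)) :=
  hQ.mul_bdd (c := C) (hη.comp continuous_fst).aestronglyMeasurable
    (Eventually.of_forall fun z => hC z.1)

theorem IsTimeTest.integrable_mul (hψ : IsTimeTest T ψ)
    (hQ : Integrable Q (volume.restrict (slab T Y))) :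
    Integrable (fun z => Q z * ψ z.1) (volume.restrict (slab T Y)) := by
  obtain ⟨C, hC⟩ := hψ.exists_abs_le
  exact integrable_mul_time hQ hψ.contDiff.continuous fun t => (hC t).1

theorem IsTimeTest.integrable_mul_deriv (hψ : IsTimeTest T ψ)
    (hQ : Integrable Q (volume.restrict (slab T Y))) :
    Integrable (fun z => Q z * deriv ψ z.1) (volume.restrict (slab T Y)) := by
  obtain ⟨C, hC⟩ := hψ.exists_abs_le
  exact integrable_mul_time hQ hψ.continuous_deriv fun t => (hC t).2

theorem IsTimeTest.integrable_tensor (hψ : IsTimeTest T ψ)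
    {u : ℝ × Y → ℝ} (hu : MemLp u ∞ (volume.restrict (slab T Y)))
    (hκ : Continuous κ) (hκc : HasCompactSupport κ) :
    Integrable (fun z => u z * (ψ z.1 * κ z.2)) (volume.restrict (slab T Y)) :=
  integrable_mul_test hu ((hψ.contDiff.continuous.comp continuous_fst).mul
    (hκ.comp continuous_snd)) (hasCompactSupport_tensor hψ.hasCompactSupport hκc)

/-- Moving a spatial derivative onto the weight leaves an error controlled by the energy itself,
which Gronwall can absorb. -/
theorem HasWeakDeriv.abs_integral_space_le {b : Y} (hq : HasWeakDeriv (slab T Y) (0, b) q g)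
    {M D : ℝ} (hQ : Integrable Q (volume.restrict (slab T Y)))
    (hqQ : ∀ᵐ z ∂(volume.restrict (slab T Y)), |q z| ≤ M * Q z)
    (hψ : IsTimeTest T ψ) (hκ : ContDiff ℝ ∞ κ) (hκc : HasCompactSupport κ)
    (hD : ∀ y, |fderiv ℝ κ y b| ≤ D) :
    |∫ z in slab T Y, g z * (ψ z.1 * κ z.2)| ≤ D * M * ∫ z in slab T Y, Q z * ψ z.1 := by
  have e : ∫ z in slab T Y, g z * (ψ z.1 * κ z.2) =
      - ∫ z in slab T Y, q z * (ψ z.1 * fderiv ℝ κ z.2 b) := by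
    rw [hq.integral_space hψ hκ hκc, neg_neg]
  rw [e, abs_neg, ← integral_const_mul, ← Real.norm_eq_abs]
  refine norm_integral_le_of_norm_le ((hψ.integrable_mul hQ).const_mul _) ?_
  filter_upwards [hqQ] with z hz
  rw [norm_mul, norm_mul, Real.norm_of_nonneg (hψ.nonneg _)]
  simp only [Real.norm_eq_abs]
  have h1 : |q z| * |fderiv ℝ κ z.2 b| ≤ (M * Q z) * D :=
    mul_le_mul hz (hD _) (abs_nonneg _) ((abs_nonneg _).trans hz)
  calc |q z| * (ψ z.1 * |fderiv ℝ κ z.2 b|) = (|q z| * |fderiv ℝ κ z.2 b|) * ψ z.1 := by ring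
    _ ≤ (M * Q z) * D * ψ z.1 := mul_le_mul_of_nonneg_right h1 (hψ.nonneg _)
    _ = D * M * (Q z * ψ z.1) := by ring

/-- The squared spatial norm of the difference of two functions with the same initial value. -/
theorem HasInitialValue.exists_norm_sq_sub {u u' : ℝ × Y → ℝ} {u₀ : Y → ℝ}
    (hu : HasInitialValue T u u₀) (hu' : HasInitialValue T u' u₀) :
    ∃ N : ℝ → ℝ, ContinuousOn N (Icc 0 T) ∧ N 0 = 0 ∧ (∀ t, 0 ≤ N t) ∧
      ∀ η : ℝ → ℝ, Integrable (fun z => (u z - u' z) ^ 2 * η z.1) (volume.restrict (slab T Y)) →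
        IntegrableOn (fun t => N t * η t) (Ioo 0 T) ∧
        ∫ z in slab T Y, (u z - u' z) ^ 2 * η z.1 = ∫ t in Ioo 0 T, N t * η t := by
  obtain ⟨w, hwc, hw, hw0⟩ := hu
  obtain ⟨w', hwc', hw', hw0'⟩ := hu'
  refine ⟨fun t => ‖w t - w' t‖ ^ 2, (hwc.sub hwc').norm.pow 2, ?_, fun t => by positivity, ?_⟩
  -- This is where the common initial datum enters.
  · have : w 0 = w' 0 := Lp.ext (hw0.symm.trans hw0')
    simp [this]
  · intro η hη
    rw [volume_restrict_slab] at hη ⊢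
    have hN : ∀ᵐ t ∂(volume.restrict (Ioo 0 T)),
        ∫ y, (u (t, y) - u' (t, y)) ^ 2 * η t = ‖w t - w' t‖ ^ 2 * η t := by
      filter_upwards [hw, hw'] with t ht ht'
      rw [integral_mul_const]
      congr 1
      rw [← real_inner_self_eq_norm_sq, L2.inner_def]
      refine integral_congr_ae ?_
      filter_upwards [ht, ht', Lp.coeFn_sub (w t) (w' t)] with y h1 h2 h3
      rw [h3]
      simp only [Pi.sub_apply, ← h1, ← h2, real_inner_self_eq_norm_sq, Real.norm_eq_abs, sq_abs]
    refine ⟨hη.integral_prod_left.congr hN, ?_⟩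
    rw [integral_prod _ hη]
    exact integral_congr_ae hN

end Slab

/-! ### Cutoff functions -/

section Cutoff

set_option linter.unusedSectionVars false

variable {Y : Type*} [NormedAddCommGroup Y] [NormedSpace ℝ Y] [FiniteDimensional ℝ Y]

theorem exists_cutoff (r : ℝ) : ∃ (R : ℝ) (χ : Y → ℝ), ContDiff ℝ ∞ χ ∧ HasCompactSupport χ ∧
    (∀ y, 0 ≤ χ y) ∧ (∀ y, χ y ≤ 1) ∧ (∀ y, ‖y‖ ≤ r → χ y = 1) ∧ ∀ y, R < ‖y‖ → χ y = 0 := by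
  let ρ : ContDiffBump (0 : Y) := ⟨|r| + 1, |r| + 2, by positivity, by linarith⟩
  refine ⟨|r| + 2, ρ, ρ.contDiff, ρ.hasCompactSupport, fun _ => ρ.nonneg, fun _ => ρ.le_one,
    fun y hy => ρ.one_of_mem_closedBall ?_, fun y hy => ρ.zero_of_le_dist ?_⟩
  · rw [mem_closedBall_zero_iff]
    show ‖y‖ ≤ |r| + 1
    linarith [le_abs_self r]
  · rw [dist_zero_right]
    exact hy.le

theorem exists_norm_fderiv_le {κ : Y → ℝ} (hκ : ContDiff ℝ ∞ κ) (hc : HasCompactSupport κ) :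
    ∃ D, ∀ y, ‖fderiv ℝ κ y‖ ≤ D :=
  (hκ.continuous_fderiv (by simp)).bounded_above_of_compact_support (hc.fderiv (𝕜 := ℝ))

theorem exists_abs_fderiv_apply_le {κ : Y → ℝ} (hκ : ContDiff ℝ ∞ κ) (hc : HasCompactSupport κ)
    (b : Y) : ∃ D, ∀ y, |fderiv ℝ κ y b| ≤ D := by
  obtain ⟨D, hD⟩ := exists_norm_fderiv_le hκ hc
  exact ⟨D * ‖b‖, fun y => ((fderiv ℝ κ y).le_opNorm b).trans
    (mul_le_mul_of_nonneg_right (hD y) (norm_nonneg _))⟩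

/-- An exhausting sequence of cutoff functions with uniformly bounded derivatives. -/
theorem exists_cutoff_seq : ∃ (D : ℝ) (χ : ℕ → Y → ℝ), (∀ n, ContDiff ℝ ∞ (χ n)) ∧
    (∀ n, HasCompactSupport (χ n)) ∧ (∀ n y, 0 ≤ χ n y) ∧ (∀ n y, χ n y ≤ 1) ∧
    (∀ n y, ‖fderiv ℝ (χ n) y‖ ≤ D) ∧ ∀ y, Tendsto (fun n => χ n y) atTop (𝓝 1) := by
  obtain ⟨-, χ, hs, hc, h0, h1, hone, -⟩ := exists_cutoff (Y := Y) 1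
  obtain ⟨D, hD⟩ := exists_norm_fderiv_le hs hc
  have hpos : ∀ n : ℕ, (0 : ℝ) < ((n : ℝ) + 1)⁻¹ := fun n => by positivity
  -- One fixed cutoff is dilated; dilation by a factor at least 1 does not increase the derivative.
  refine ⟨D, fun n y => χ (((n : ℝ) + 1)⁻¹ • y), fun n => hs.comp (contDiff_const_smul _),
    fun n => hc.comp_homeomorph (Homeomorph.smulOfNeZero _ (hpos n).ne'), fun n y => h0 _,
    fun n y => h1 _, fun n y => ?_, fun y => ?_⟩
  · rw [fderiv_comp_smul, norm_smul, Real.norm_of_nonneg (hpos n).le]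
    refine (mul_le_of_le_one_left (norm_nonneg _) ?_).trans (hD _)
    exact inv_le_one_of_one_le₀ (by linarith [n.cast_nonneg (α := ℝ)])
  · refine tendsto_const_nhds.congr' ?_
    obtain ⟨m, hm⟩ := exists_nat_ge ‖y‖
    filter_upwards [eventually_ge_atTop m] with n hn
    refine (hone _ ?_).symm
    rw [norm_smul, Real.norm_of_nonneg (hpos n).le, inv_mul_le_iff₀ (by positivity)]
    have : (m : ℝ) ≤ n := by exact_mod_cast hn
    linarith

end Cutoff

/-! ### Slabs over a product space -/

section Product

set_option linter.unusedSectionVars false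

variable {X P : Type*} [NormedAddCommGroup X] [NormedSpace ℝ X] [MeasureSpace X]
  [BorelSpace X] [FiniteDimensional ℝ X] [(volume : Measure X).IsAddHaarMeasure]
  [NormedAddCommGroup P] [NormedSpace ℝ P] [MeasureSpace P]
  [BorelSpace P] [FiniteDimensional ℝ P] [(volume : Measure P).IsAddHaarMeasure]
  {T : ℝ}

instance : (volume : Measure (X × P)).IsAddHaarMeasure :=
  Measure.prod.instIsAddHaarMeasure volume volume

theorem measurePreserving_prodAssoc_slab (T : ℝ) :
    MeasurePreserving (MeasurableEquiv.prodAssoc : (ℝ × X) × P ≃ᵐ ℝ × X × P)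
      ((volume.restrict (slab T X)).prod volume) (volume.restrict (slab T (X × P))) := by
  rw [volume_restrict_slab, volume_restrict_slab, Measure.volume_eq_prod]
  exact measurePreserving_prodAssoc _ _ _

/-- Forgetting $p$ cannot preserve measure when $P$ has infinite volume, but preimages of null sets
are null, which is all that essential bounds need. -/
theorem quasiMeasurePreserving_slab (T : ℝ) :
    Measure.QuasiMeasurePreserving (fun z : ℝ × X × P => (z.1, z.2.1))
      (volume.restrict (slab T (X × P))) (volume.restrict (slab T X)) :=
  Measure.quasiMeasurePreserving_fst.comp
    ((measurePreserving_prodAssoc_slab (X := X) (P := P) T).symm _).quasiMeasurePreserving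

theorem memLp_top_comp_slab {m : ℝ × X → ℝ} (hm : MemLp m ∞ (volume.restrict (slab T X))) :
    MemLp (fun z : ℝ × X × P => m (z.1, z.2.1)) ∞ (volume.restrict (slab T (X × P))) := by
  obtain ⟨C, -, hC⟩ := exists_ae_abs_le_of_memLp_top hm
  exact memLp_top_of_bound (hm.1.comp_quasiMeasurePreserving (quasiMeasurePreserving_slab T)) C
    ((quasiMeasurePreserving_slab T).ae hC)

section Fubini

variable {F : ℝ × X × P → ℝ}

theorem integrable_assoc_slab
    (hF : Integrable F (volume.restrict (slab T (X × P)))) :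
    Integrable (fun q : (ℝ × X) × P => F (q.1.1, q.1.2, q.2))
      ((volume.restrict (slab T X)).prod volume) :=
  (measurePreserving_prodAssoc_slab T).integrable_comp_of_integrable hF

theorem integrable_integral_slab
    (hF : Integrable F (volume.restrict (slab T (X × P)))) :
    Integrable (fun w : ℝ × X => ∫ p, F (w.1, w.2, p)) (volume.restrict (slab T X)) :=
  (integrable_assoc_slab hF).integral_prod_left

theorem integral_slab_prod
    (hF : Integrable F (volume.restrict (slab T (X × P)))) :
    ∫ z in slab T (X × P), F z = ∫ w in slab T X, ∫ p, F (w.1, w.2, p) := by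
  rw [← (measurePreserving_prodAssoc_slab T).integral_comp']
  exact integral_prod _ (integrable_assoc_slab hF)

theorem ae_integrable_slab
    (hF : Integrable F (volume.restrict (slab T (X × P)))) :
    ∀ᵐ w ∂(volume.restrict (slab T X)), Integrable (fun p => F (w.1, w.2, p)) :=
  (integrable_assoc_slab hF).prod_right_ae

end Fubini

theorem ae_ae_of_ae_slab {p : ℝ × X × P → Prop}
    (h : ∀ᵐ z ∂(volume.restrict (slab T (X × P))), p z) :
    ∀ᵐ w ∂(volume.restrict (slab T X)), ∀ᵐ y : P, p (w.1, w.2, y) :=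
  Measure.ae_ae_of_ae_prod
    ((measurePreserving_prodAssoc_slab (X := X) (P := P) T).quasiMeasurePreserving.ae h)

theorem integrable_mul_snd_slab {m : ℝ × X → ℝ} {k : P → ℝ}
    (hm : Integrable m (volume.restrict (slab T X))) (hk : Integrable k) :
    Integrable (fun z : ℝ × X × P => m (z.1, z.2.1) * k z.2.2)
      (volume.restrict (slab T (X × P))) :=
  ((measurePreserving_prodAssoc_slab (X := X) (P := P) T).symm _).integrable_comp_of_integrable
    (hm.mul_prod hk)

theorem integral_mul_snd_slab {m : ℝ × X → ℝ} {k : P → ℝ}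
    (hm : Integrable m (volume.restrict (slab T X))) (hk : Integrable k) :
    ∫ z in slab T (X × P), m (z.1, z.2.1) * k z.2.2 = (∫ w in slab T X, m w) * ∫ p, k p := by
  rw [integral_slab_prod (integrable_mul_snd_slab hm hk)]
  simp only [Prod.mk.eta, integral_const_mul, integral_mul_const]

theorem integral_fderiv_snd_eq_zero {φ : ℝ × X × P → ℝ} (hφ : ContDiff ℝ ∞ φ)
    (hc : HasCompactSupport φ) (b : P) (t : ℝ) (x : X) :
    ∫ p, fderiv ℝ φ (t, x, p) (0, 0, b) = 0 := by
  set κ : P → ℝ := fun p => φ (t, x, p) with hκ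
  have hκs : ContDiff ℝ ∞ κ := hφ.comp (contDiff_const.prodMk (contDiff_const.prodMk contDiff_id))
  have hκc : HasCompactSupport κ :=
    HasCompactSupport.intro (IsCompact.image hc (continuous_snd.comp continuous_snd)) fun p hp =>
      show φ (t, x, p) = 0 from image_eq_zero_of_notMem_tsupport fun h => hp ⟨(t, x, p), h, rfl⟩
  have hd : ∀ p, fderiv ℝ φ (t, x, p) (0, 0, b) = fderiv ℝ κ p b := by
    intro p
    have h1 := (hasFDerivAt_const (𝕜 := ℝ) t p).prodMk
      ((hasFDerivAt_const (𝕜 := ℝ) x p).prodMk (hasFDerivAt_id (𝕜 := ℝ) p))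
    have h2 : fderiv ℝ κ p = _ :=
      ((hφ.differentiable (by simp) (t, x, p)).hasFDerivAt.comp p h1).fderiv
    rw [h2]
    simp
  simp_rw [hd]
  have hi1 := (continuous_fderiv_apply_const hκs b).integrable_of_hasCompactSupport (μ := volume)
    (hasCompactSupport_fderiv_apply hκc b)
  have hi2 := hκs.continuous.integrable_of_hasCompactSupport (μ := volume) hκc
  have := integral_mul_fderiv_eq_neg_fderiv_mul_of_integrable (μ := (volume : Measure P))
    (f := fun _ => (1 : ℝ)) (g := κ) (v := b) (by simp) (by simpa using hi1) (by simpa using hi2)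
    (fun x _ => differentiableAt_const _) (fun x _ => hκs.differentiable (by simp) x)
  simpa using this

/-- By Fubini, $m(t,x)$ comes out of the $p$-integral, and a compactly supported derivative
integrates to zero. This lets $E$ and $B$ pass through momentum derivatives. -/
theorem hasWeakDeriv_snd_zero {m : ℝ × X → ℝ} (hm : MemLp m ∞ (volume.restrict (slab T X)))
    (b : P) : HasWeakDeriv (slab T (X × P)) (0, 0, b) (fun z => m (z.1, z.2.1)) (fun _ => 0) where
  locallyIntegrableOn := locallyIntegrableOn_of_memLp_top (memLp_top_comp_slab hm)
  locallyIntegrableOn_deriv := locallyIntegrableOn_const 0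
  integral_eq φ hφ hc hs := by
    have hi := integrable_mul_test (memLp_top_comp_slab (P := P) hm)
      (continuous_fderiv_apply_const hφ (0, 0, b)) (hasCompactSupport_fderiv_apply hc _)
    rw [integral_slab_prod hi]
    simp only [Prod.mk.eta, integral_const_mul, integral_fderiv_snd_eq_zero hφ hc]
    simp

end Product

/-! ### Energy estimate for the fields -/

theorem norm_basisVec (i : Fin 2) : ‖basisVec i‖ = 1 := by simp [basisVec]

/-- The right-hand side of the pointwise hypothesis is a divergence plus a source $G$. The fields
need not have compact support, so the divergence is integrated against a cutoff $\chi_n$ that is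
finally sent to 1. -/
theorem field_energy {T : ℝ} {e₁ e₂ b e₁t e₂t bt e₁₂ e₂₁ b₁ b₂ Q G : ℝ × Plane → ℝ}
    (he₁t : HasWeakDeriv (slab T Plane) (1, 0) e₁ e₁t)
    (he₂t : HasWeakDeriv (slab T Plane) (1, 0) e₂ e₂t)
    (hbt : HasWeakDeriv (slab T Plane) (1, 0) b bt)
    (he₁₂ : HasWeakDeriv (slab T Plane) (0, basisVec 1) e₁ e₁₂)
    (he₂₁ : HasWeakDeriv (slab T Plane) (0, basisVec 0) e₂ e₂₁)
    (hb₁ : HasWeakDeriv (slab T Plane) (0, basisVec 0) b b₁)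
    (hb₂ : HasWeakDeriv (slab T Plane) (0, basisVec 1) b b₂)
    (me₁ : MemLp e₁ ∞ (volume.restrict (slab T Plane)))
    (me₂ : MemLp e₂ ∞ (volume.restrict (slab T Plane)))
    (mb : MemLp b ∞ (volume.restrict (slab T Plane)))
    (me₁t : MemLp e₁t ∞ (volume.restrict (slab T Plane)))
    (me₂t : MemLp e₂t ∞ (volume.restrict (slab T Plane)))
    (mbt : MemLp bt ∞ (volume.restrict (slab T Plane)))
    (me₁₂ : MemLp e₁₂ ∞ (volume.restrict (slab T Plane)))
    (me₂₁ : MemLp e₂₁ ∞ (volume.restrict (slab T Plane)))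
    (mb₁ : MemLp b₁ ∞ (volume.restrict (slab T Plane)))
    (mb₂ : MemLp b₂ ∞ (volume.restrict (slab T Plane)))
    (hQ : Integrable Q (volume.restrict (slab T Plane)))
    (hG : Integrable G (volume.restrict (slab T Plane))) (hG0 : ∀ z, 0 ≤ G z)
    (hQeq : ∀ z, Q z = e₁ z ^ 2 + e₂ z ^ 2 + b z ^ 2)
    (hle : ∀ᵐ z ∂(volume.restrict (slab T Plane)),
      e₁ z * e₁t z + e₂ z * e₂t z + b z * bt z ≤
        (e₁₂ z * b z + e₁ z * b₂ z) - (e₂₁ z * b z + e₂ z * b₁ z) + G z) :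
    ∃ C : ℝ, ∀ ψ, IsTimeTest T ψ →
      - ∫ z in slab T Plane, Q z * deriv ψ z.1 ≤
        C * (∫ z in slab T Plane, Q z * ψ z.1) + 2 * ∫ z in slab T Plane, G z * ψ z.1 := by
  have hΩ : IsOpen (slab T Plane) := isOpen_slab T
  obtain ⟨D, χ, hχs, hχc, hχ0, hχ1, hχD, hχlim⟩ := exists_cutoff_seq (Y := Plane)
  -- Two flux terms occur, each with factor 2 from $\partial_t(u^2)=2u\,\partial_tu$ and each
  -- bounded by $D\int Q\psi$. This bound is uniform in $n$, so the derivatives of the cutoffs need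
  -- not tend to zero.
  refine ⟨4 * D, fun ψ hψ => ?_⟩
  have hsq : ∀ {u g : ℝ × Plane → ℝ}, HasWeakDeriv (slab T Plane) (1, 0) u g →
      MemLp u ∞ (volume.restrict (slab T Plane)) → MemLp g ∞ (volume.restrict (slab T Plane)) →
      HasWeakDeriv (slab T Plane) (1, 0) (fun z => u z * u z) (fun z => g z * u z + u z * g z) :=
    fun h mu mg => h.mul hΩ h mu mg mu mg
  have hp₂ := he₁₂.mul hΩ hb₂ me₁ me₁₂ mb mb₂
  have hp₁ := he₂₁.mul hΩ hb₁ me₂ me₂₁ mb mb₁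
  have mp₂ := (memLp_top_mul me₁₂ mb).fun_add (memLp_top_mul me₁ mb₂)
  have mp₁ := (memLp_top_mul me₂₁ mb).fun_add (memLp_top_mul me₂ mb₁)
  have m11 := (memLp_top_mul me₁t me₁).fun_add (memLp_top_mul me₁ me₁t)
  have m22 := (memLp_top_mul me₂t me₂).fun_add (memLp_top_mul me₂ me₂t)
  have m33 := (memLp_top_mul mbt mb).fun_add (memLp_top_mul mb mbt)
  have hD : ∀ n i y, |fderiv ℝ (χ n) y (basisVec i)| ≤ D := fun n i y => by
    have := ((fderiv ℝ (χ n) y).le_opNorm (basisVec i)).trans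
      (mul_le_mul_of_nonneg_right (hχD n y) (norm_nonneg _))
    rwa [norm_basisVec, mul_one] at this
  have hbound : ∀ n, - ∫ z in slab T Plane, Q z * (deriv ψ z.1 * χ n z.2) ≤
      4 * D * (∫ z in slab T Plane, Q z * ψ z.1) + 2 * ∫ z in slab T Plane, G z * ψ z.1 := by
    intro n
    have t1 := (hsq he₁t me₁ me₁t).integral_time hψ (hχs n) (hχc n)
    have t2 := (hsq he₂t me₂ me₂t).integral_time hψ (hχs n) (hχc n)
    have t3 := (hsq hbt mb mbt).integral_time hψ (hχs n) (hχc n)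
    have s2 := hp₂.abs_integral_space_le (M := 1) hQ (Eventually.of_forall fun z => by
      rw [hQeq, abs_le]; constructor <;>
      nlinarith [sq_nonneg (e₁ z + b z), sq_nonneg (e₁ z - b z), sq_nonneg (e₂ z), sq_nonneg (b z),
        sq_nonneg (e₁ z)]) hψ (hχs n) (hχc n) (hD n 1)
    have s1 := hp₁.abs_integral_space_le (M := 1) hQ (Eventually.of_forall fun z => by
      rw [hQeq, abs_le]; constructor <;>
      nlinarith [sq_nonneg (e₂ z + b z), sq_nonneg (e₂ z - b z), sq_nonneg (e₁ z), sq_nonneg (b z),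
        sq_nonneg (e₂ z)]) hψ (hχs n) (hχc n) (hD n 0)
    have ctest : Continuous (fun z : ℝ × Plane => deriv ψ z.1 * χ n z.2) :=
      (hψ.continuous_deriv.comp continuous_fst).mul ((hχs n).continuous.comp continuous_snd)
    have stest : HasCompactSupport (fun z : ℝ × Plane => deriv ψ z.1 * χ n z.2) :=
      hasCompactSupport_tensor hψ.hasCompactSupport.deriv (hχc n)
    have j1 := integrable_mul_test (memLp_top_mul me₁ me₁) ctest stest
    have j2 := integrable_mul_test (memLp_top_mul me₂ me₂) ctest stest
    have j3 := integrable_mul_test (memLp_top_mul mb mb) ctest stest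
    have i1 := hψ.integrable_tensor m11 (hχs n).continuous (hχc n)
    have i2 := hψ.integrable_tensor m22 (hχs n).continuous (hχc n)
    have i3 := hψ.integrable_tensor m33 (hχs n).continuous (hχc n)
    have k1 := hψ.integrable_tensor mp₁ (hχs n).continuous (hχc n)
    have k2 := hψ.integrable_tensor mp₂ (hχs n).continuous (hχc n)
    have kG := hψ.integrable_mul hG
    have eQ : ∫ z in slab T Plane, Q z * (deriv ψ z.1 * χ n z.2) =
        (∫ z in slab T Plane, e₁ z * e₁ z * (deriv ψ z.1 * χ n z.2)) +
        (∫ z in slab T Plane, e₂ z * e₂ z * (deriv ψ z.1 * χ n z.2)) +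
        ∫ z in slab T Plane, b z * b z * (deriv ψ z.1 * χ n z.2) := by
      rw [← integral_add j1 j2, ← integral_add (j1.fun_add j2) j3]
      refine integral_congr_ae (Eventually.of_forall fun z => ?_)
      simp only [hQeq]
      ring
    have hmono := integral_mono_ae ((i1.fun_add i2).fun_add i3)
      (((k2.const_mul 2).fun_sub (k1.const_mul 2)).fun_add (kG.const_mul 2)) (by
        filter_upwards [hle] with z hz
        have hw : 0 ≤ ψ z.1 * χ n z.2 := mul_nonneg (hψ.nonneg _) (hχ0 n _)
        have h1 := mul_le_mul_of_nonneg_right hz hw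
        have h2 : G z * (ψ z.1 * χ n z.2) ≤ G z * ψ z.1 :=
          mul_le_mul_of_nonneg_left (mul_le_of_le_one_right (hψ.nonneg _) (hχ1 n _)) (hG0 z)
        linear_combination 2 * h1 + 2 * h2)
    rw [integral_add (i1.fun_add i2) i3, integral_add i1 i2,
      integral_add ((k2.const_mul 2).fun_sub (k1.const_mul 2)) (kG.const_mul 2),
      integral_sub (k2.const_mul 2) (k1.const_mul 2), integral_const_mul, integral_const_mul,
      integral_const_mul] at hmono
    rw [eQ, t1, t2, t3]
    have := le_abs_self (∫ z in slab T Plane,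
      (e₁₂ z * b z + e₁ z * b₂ z) * (ψ z.1 * χ n z.2))
    have := neg_abs_le (∫ z in slab T Plane,
      (e₂₁ z * b z + e₂ z * b₁ z) * (ψ z.1 * χ n z.2))
    linarith
  have hlim : Tendsto (fun n => - ∫ z in slab T Plane, Q z * (deriv ψ z.1 * χ n z.2)) atTop
      (𝓝 (- ∫ z in slab T Plane, Q z * deriv ψ z.1)) := by
    refine (tendsto_integral_of_dominated_convergence (fun z => ‖Q z * deriv ψ z.1‖)
      (fun n => ?_) (hψ.integrable_mul_deriv hQ).norm (fun n => ?_) ?_).neg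
    · exact hQ.1.mul ((hψ.continuous_deriv.comp continuous_fst).mul
        ((hχs n).continuous.comp continuous_snd)).aestronglyMeasurable
    · refine Eventually.of_forall fun z => ?_
      rw [← mul_assoc, norm_mul _ (χ n z.2), Real.norm_of_nonneg (hχ0 n _)]
      exact mul_le_of_le_one_right (norm_nonneg _) (hχ1 n _)
    · refine Eventually.of_forall fun z => ?_
      have := ((hχlim z.2).const_mul (deriv ψ z.1)).const_mul (Q z)
      rwa [mul_one] at this
  exact le_of_tendsto' hlim hbound

/-! ### Energy estimate for the density -/

theorem contDiff_vel (i : Fin 2) : ContDiff ℝ ∞ (fun p : Plane => vel p i) := by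
  have h1 : ContDiff ℝ ∞ (fun p : Plane => Real.sqrt (1 + ‖p‖ ^ 2)) :=
    (contDiff_const.add (contDiff_norm_sq ℝ)).sqrt fun p => by positivity
  have h2 : ContDiff ℝ ∞ vel := (h1.inv fun p => by positivity).smul contDiff_id
  exact contDiff_euclidean.1 h2 i

theorem abs_vel_le_one (p : Plane) (i : Fin 2) : |vel p i| ≤ 1 := by
  have h1 : ‖vel p i‖ ≤ ‖vel p‖ := PiLp.norm_apply_le (vel p) i
  refine h1.trans ?_
  rw [vel, norm_smul, norm_inv, Real.norm_of_nonneg (Real.sqrt_nonneg _),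
    inv_mul_le_iff₀ (by positivity), mul_one]
  exact Real.le_sqrt_of_sq_le (by linarith)

theorem contDiff_perp_vel (i : Fin 2) : ContDiff ℝ ∞ (fun p : Plane => perp (vel p) i) := by
  fin_cases i
  · exact (contDiff_vel 1).neg
  · exact contDiff_vel 0

theorem abs_perp_vel_le_one (p : Plane) (i : Fin 2) : |perp (vel p) i| ≤ 1 := by
  fin_cases i
  · simpa [perp] using abs_vel_le_one p 1
  · simpa [perp] using abs_vel_le_one p 0

/-- Multiply the equation by $2d\,\psi\chi$ and move the $x$- and $p$-derivatives of $d^2$ onto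
smooth weights. Bounds for the derivatives of these weights suffice; the force field need not be
recognised as divergence free in $p$. -/
theorem vlasov_energy {T r : ℝ} {d dt : ℝ × Plane × Plane → ℝ}
    {dx dp Df : Fin 2 → ℝ × Plane × Plane → ℝ} {E e : Fin 2 → ℝ × Plane → ℝ}
    {B b Q : ℝ × Plane → ℝ}
    (hdt : HasWeakDeriv (slab T (Plane × Plane)) (1, 0, 0) d dt)
    (hdx : ∀ i, HasWeakDeriv (slab T (Plane × Plane)) (0, basisVec i, 0) d (dx i))
    (hdp : ∀ i, HasWeakDeriv (slab T (Plane × Plane)) (0, 0, basisVec i) d (dp i))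
    (md : MemLp d ∞ (volume.restrict (slab T (Plane × Plane))))
    (mdt : MemLp dt ∞ (volume.restrict (slab T (Plane × Plane))))
    (mdx : ∀ i, MemLp (dx i) ∞ (volume.restrict (slab T (Plane × Plane))))
    (mdp : ∀ i, MemLp (dp i) ∞ (volume.restrict (slab T (Plane × Plane))))
    (mDf : ∀ i, MemLp (Df i) ∞ (volume.restrict (slab T (Plane × Plane))))
    (mE : ∀ i, MemLp (E i) ∞ (volume.restrict (slab T Plane)))
    (mB : MemLp B ∞ (volume.restrict (slab T Plane)))
    (hd2 : Integrable (fun z => d z ^ 2) (volume.restrict (slab T (Plane × Plane))))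
    (hQ : Integrable Q (volume.restrict (slab T Plane)))
    (hQeq : ∀ z, Q z = e 0 z ^ 2 + e 1 z ^ 2 + b z ^ 2)
    (hsupp : ∀ᵐ z ∂(volume.restrict (slab T (Plane × Plane))),
      d z ≠ 0 → ‖z.2.1‖ < r ∧ ‖z.2.2‖ < r)
    (heq : ∀ᵐ z ∂(volume.restrict (slab T (Plane × Plane))),
      dt z + ∑ i, vel z.2.2 i * dx i z
        + ∑ i, (E i (z.1, z.2.1) - B (z.1, z.2.1) * perp (vel z.2.2) i) * dp i z
        + ∑ i, (e i (z.1, z.2.1) - b (z.1, z.2.1) * perp (vel z.2.2) i) * Df i z = 0) :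
    ∃ C C' : ℝ, ∀ ψ, IsTimeTest T ψ →
      - ∫ z in slab T (Plane × Plane), d z ^ 2 * deriv ψ z.1 ≤
        C * (∫ z in slab T (Plane × Plane), d z ^ 2 * ψ z.1) +
          C' * ∫ z in slab T Plane, Q z * ψ z.1 := by
  have hΩ : IsOpen (slab T (Plane × Plane)) := isOpen_slab T
  obtain ⟨R, χ, hχs, hχc, hχ0, hχ1, hχone, hχzero⟩ := exists_cutoff (Y := Plane × Plane) r
  obtain ⟨M₀, hM₀, hDf₀⟩ := exists_ae_abs_le_of_memLp_top (mDf 0)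
  obtain ⟨M₁, hM₁, hDf₁⟩ := exists_ae_abs_le_of_memLp_top (mDf 1)
  set M := max M₀ M₁ with hM
  have hM0 : 0 ≤ M := hM₀.trans (le_max_left _ _)
  obtain ⟨CE₀, hCE₀, hE₀⟩ := exists_ae_abs_le_of_memLp_top (memLp_top_comp_slab (P := Plane) (mE 0))
  obtain ⟨CE₁, hCE₁, hE₁⟩ := exists_ae_abs_le_of_memLp_top (memLp_top_comp_slab (P := Plane) (mE 1))
  obtain ⟨CB, hCB, hB⟩ := exists_ae_abs_le_of_memLp_top (memLp_top_comp_slab (P := Plane) mB)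
  -- weights for the space and momentum derivatives
  have hvs : ∀ i, ContDiff ℝ ∞ (fun y : Plane × Plane => χ y * vel y.2 i) := fun i =>
    hχs.mul ((contDiff_vel i).comp contDiff_snd)
  have hvc : ∀ i, HasCompactSupport (fun y : Plane × Plane => χ y * vel y.2 i) := fun i =>
    hχc.mul_right
  have hps : ∀ i, ContDiff ℝ ∞ (fun y : Plane × Plane => χ y * perp (vel y.2) i) := fun i =>
    hχs.mul ((contDiff_perp_vel i).comp contDiff_snd)
  have hpc : ∀ i, HasCompactSupport (fun y : Plane × Plane => χ y * perp (vel y.2) i) := fun i =>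
    hχc.mul_right
  choose Dv hDv using fun i => exists_abs_fderiv_apply_le (hvs i) (hvc i) (basisVec i, 0)
  choose De hDe using fun i : Fin 2 =>
    exists_abs_fderiv_apply_le hχs hχc ((0, basisVec i) : Plane × Plane)
  choose Dp hDp using fun i => exists_abs_fderiv_apply_le (hps i) (hpc i) (0, basisVec i)
  -- derivatives of `d²`, `d² E_i`, `d² B`
  have md2 := memLp_top_mul md md
  have hxx := fun i => (hdx i).mul hΩ (hdx i) md (mdx i) md (mdx i)
  have hpp := fun i => (hdp i).mul hΩ (hdp i) md (mdp i) md (mdp i)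
  have mxx := fun i => (memLp_top_mul (mdx i) md).fun_add (memLp_top_mul md (mdx i))
  have mpp := fun i => (memLp_top_mul (mdp i) md).fun_add (memLp_top_mul md (mdp i))
  have mz : MemLp (fun _ : ℝ × Plane × Plane => (0 : ℝ)) ∞
      (volume.restrict (slab T (Plane × Plane))) := MemLp.zero'
  -- The nonsmooth coefficients $E_i$ and $B$ join $d^2$ as the differentiated function, at no cost
  -- since they do not depend on $p$. The smooth $\widehat p$ and $\widehat p^\perp$ go into the
  -- weights.
  have hpE := fun i => (hpp i).mul hΩ (hasWeakDeriv_snd_zero (mE i) (basisVec i)) md2 (mpp i)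
    (memLp_top_comp_slab (mE i)) mz
  have hpB := fun i => (hpp i).mul hΩ (hasWeakDeriv_snd_zero mB (basisVec i)) md2 (mpp i)
    (memLp_top_comp_slab mB) mz
  have mpE := fun i => (memLp_top_mul (mpp i) (memLp_top_comp_slab (P := Plane) (mE i))).fun_add
    (memLp_top_mul md2 mz)
  have mpB := fun i => (memLp_top_mul (mpp i) (memLp_top_comp_slab (P := Plane) mB)).fun_add
    (memLp_top_mul md2 mz)
  have hk := integrable_indicator_closedBall (Y := Plane) R
  set k : Plane → ℝ := (Metric.closedBall (0 : Plane) R).indicator fun _ => (1 : ℝ) with hkdef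
  -- The term $Q(t,x)$ is not integrable in $p$ over the plane; dominating $\chi$ by an indicator in
  -- $p$ alone turns its integral into a product.
  have hkχ : ∀ y : Plane × Plane, χ y ≤ k y.2 := by
    intro y
    by_cases hy : y.2 ∈ Metric.closedBall (0 : Plane) R
    · rw [hkdef, indicator_of_mem hy]; exact hχ1 y
    · rw [hkdef, indicator_of_notMem hy]
      refine (hχzero y ?_).le
      rw [mem_closedBall_zero_iff, not_le] at hy
      exact hy.trans_le (norm_snd_le y)
  -- The first six terms come from the moved derivatives. The source contributes, for each of two
  -- components, $M(2d^2+e_i^2+b^2)$, in total at most $4Md^2+2MQ$.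
  refine ⟨(Dv 0 + Dv 1 + De 0 * CE₀ + De 1 * CE₁ + Dp 0 * CB + Dp 1 * CB) + 4 * M,
    2 * M * ∫ p, k p, fun ψ hψ => ?_⟩
  have t1 := (hdt.mul hΩ hdt md mdt md mdt).integral_time hψ hχs hχc
  have hle : ∀ {C : ℝ} {m : ℝ × Plane × Plane → ℝ},
      (∀ᵐ z ∂(volume.restrict (slab T (Plane × Plane))), |m z| ≤ C) →
      ∀ᵐ z ∂(volume.restrict (slab T (Plane × Plane))), |d z * d z * m z| ≤ C * d z ^ 2 := by
    intro C m hm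
    filter_upwards [hm] with z hz
    rw [abs_mul, abs_mul_self, ← pow_two, mul_comm]
    exact mul_le_mul_of_nonneg_right hz (sq_nonneg _)
  have hle1 : ∀ᵐ z ∂(volume.restrict (slab T (Plane × Plane))), |d z * d z| ≤ 1 * d z ^ 2 :=
    Eventually.of_forall fun z => by rw [abs_mul_self, one_mul, pow_two]
  have sx := fun i => (hxx i).abs_integral_space_le hd2 hle1 hψ (hvs i) (hvc i) (hDv i)
  have sE₀ := (hpE 0).abs_integral_space_le hd2 (hle hE₀) hψ hχs hχc (hDe 0)
  have sE₁ := (hpE 1).abs_integral_space_le hd2 (hle hE₁) hψ hχs hχc (hDe 1)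
  have sB := fun i => (hpB i).abs_integral_space_le hd2 (hle hB) hψ (hps i) (hpc i) (hDp i)
  have it := hψ.integrable_tensor ((memLp_top_mul mdt md).fun_add (memLp_top_mul md mdt))
    hχs.continuous hχc
  have ix := fun i => hψ.integrable_tensor (mxx i) (hvs i).continuous (hvc i)
  have iE := fun i => hψ.integrable_tensor (mpE i) hχs.continuous hχc
  have iB := fun i => hψ.integrable_tensor (mpB i) (hps i).continuous (hpc i)
  have id2 := (hψ.integrable_mul hd2).const_mul (4 * M)
  have iQ := (integrable_mul_snd_slab (P := Plane) (hψ.integrable_mul hQ) hk).const_mul (2 * M)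
  have hmono := integral_mono_ae it
    ((((((((ix 0).fun_neg.fun_sub (ix 1)).fun_sub (iE 0)).fun_sub (iE 1)).fun_add (iB 0)).fun_add
      (iB 1)).fun_add id2).fun_add iQ)
    (by
      filter_upwards [heq, hDf₀, hDf₁] with z hz h0 h1
      simp only [Fin.sum_univ_two] at hz
      have hw : 0 ≤ ψ z.1 * χ z.2 := mul_nonneg (hψ.nonneg _) (hχ0 _)
      have hQ0 : 0 ≤ Q (z.1, z.2.1) := by rw [hQeq]; positivity
      have hq : ∀ i : Fin 2, |Df i z| ≤ M →
          -(2 * d z * ((e i (z.1, z.2.1) - b (z.1, z.2.1) * perp (vel z.2.2) i) * Df i z)) ≤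
            M * (2 * d z ^ 2 + e i (z.1, z.2.1) ^ 2 + b (z.1, z.2.1) ^ 2) := by
        intro i hi
        have hP := abs_perp_vel_le_one z.2.2 i
        generalize perp (vel z.2.2) i = p at hP ⊢
        generalize e i (z.1, z.2.1) = x
        generalize b (z.1, z.2.1) = y
        generalize Df i z = F at hi ⊢
        refine (neg_le_abs _).trans ?_
        rw [abs_mul, abs_mul, abs_mul, abs_two]
        have a1 : |x - y * p| ≤ |x| + |y| := by
          refine (abs_sub _ _).trans ?_
          rw [abs_mul]
          have := mul_le_mul_of_nonneg_left hP (abs_nonneg y)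
          linarith
        have a2 : |x - y * p| * |F| ≤ (|x| + |y|) * M :=
          mul_le_mul a1 hi (abs_nonneg _) (by positivity)
        have a3 : 2 * |d z| * (|x - y * p| * |F|) ≤ 2 * |d z| * ((|x| + |y|) * M) :=
          mul_le_mul_of_nonneg_left a2 (by positivity)
        have a4 : 2 * |d z| * (|x| + |y|) ≤ 2 * d z ^ 2 + x ^ 2 + y ^ 2 := by
          rw [← sq_abs (d z), ← sq_abs x, ← sq_abs y]
          nlinarith [sq_nonneg (|d z| - |x|), sq_nonneg (|d z| - |y|)]
        have a5 := mul_le_mul_of_nonneg_right a4 hM0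
        linarith
      have q0 := mul_le_mul_of_nonneg_right (hq 0 (h0.trans (le_max_left _ _))) hw
      have q1 := mul_le_mul_of_nonneg_right (hq 1 (h1.trans (le_max_right _ _))) hw
      have hd4 : 4 * M * d z ^ 2 * (ψ z.1 * χ z.2) ≤ 4 * M * (d z ^ 2 * ψ z.1) := by
        have := mul_le_mul_of_nonneg_left (hχ1 z.2)
          (show 0 ≤ 4 * M * (d z ^ 2 * ψ z.1) from
            mul_nonneg (by positivity) (mul_nonneg (sq_nonneg _) (hψ.nonneg _)))
        linarith
      have hQk : 2 * M * Q (z.1, z.2.1) * (ψ z.1 * χ z.2) ≤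
          2 * M * (Q (z.1, z.2.1) * ψ z.1 * k z.2.2) := by
        have := mul_le_mul_of_nonneg_left (hkχ z.2)
          (show 0 ≤ 2 * M * (Q (z.1, z.2.1) * ψ z.1) from
            mul_nonneg (by positivity) (mul_nonneg hQ0 (hψ.nonneg _)))
        linarith
      have hQ2 : M * (e 0 (z.1, z.2.1) ^ 2 + e 1 (z.1, z.2.1) ^ 2 + 2 * b (z.1, z.2.1) ^ 2) *
          (ψ z.1 * χ z.2) ≤ 2 * M * Q (z.1, z.2.1) * (ψ z.1 * χ z.2) := by
        refine mul_le_mul_of_nonneg_right ?_ hw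
        rw [hQeq, mul_comm 2 M, mul_assoc]
        exact mul_le_mul_of_nonneg_left
          (by nlinarith [sq_nonneg (e 0 (z.1, z.2.1)), sq_nonneg (e 1 (z.1, z.2.1))]) hM0
      linear_combination q0 + q1 + hd4 + hQk + hQ2 + 2 * d z * (ψ z.1 * χ z.2) * hz)
  rw [integral_add ((((((((ix 0).fun_neg.fun_sub (ix 1)).fun_sub (iE 0)).fun_sub (iE 1)).fun_add
      (iB 0)).fun_add (iB 1)).fun_add id2)) iQ,
    integral_add ((((((ix 0).fun_neg.fun_sub (ix 1)).fun_sub (iE 0)).fun_sub (iE 1)).fun_add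
      (iB 0)).fun_add (iB 1)) id2,
    integral_add (((((ix 0).fun_neg.fun_sub (ix 1)).fun_sub (iE 0)).fun_sub (iE 1)).fun_add
      (iB 0)) (iB 1),
    integral_add ((((ix 0).fun_neg.fun_sub (ix 1)).fun_sub (iE 0)).fun_sub (iE 1)) (iB 0),
    integral_sub (((ix 0).fun_neg.fun_sub (ix 1)).fun_sub (iE 0)) (iE 1),
    integral_sub ((ix 0).fun_neg.fun_sub (ix 1)) (iE 0), integral_sub (ix 0).fun_neg (ix 1),
    integral_neg, integral_const_mul, integral_const_mul,
    integral_mul_snd_slab (hψ.integrable_mul hQ) hk] at hmono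
  -- Since $\chi=1$ wherever $d\ne0$, the cutoff costs nothing in the time term and no limit is
  -- needed.
  have e : ∫ z in slab T (Plane × Plane), d z ^ 2 * deriv ψ z.1 =
      ∫ z in slab T (Plane × Plane), d z * d z * (deriv ψ z.1 * χ z.2) := by
    refine integral_congr_ae ?_
    filter_upwards [hsupp] with z hz
    by_cases h0 : d z = 0
    · simp [h0]
    · obtain ⟨h1, h2⟩ := hz h0
      rw [hχone z.2 (max_le h1.le h2.le), mul_one, pow_two]
  rw [e, t1, neg_neg]
  have x0 := (neg_abs_le _).trans' (neg_le_neg (sx 0))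
  have x1 := (neg_abs_le _).trans' (neg_le_neg (sx 1))
  have y0 := (neg_abs_le _).trans' (neg_le_neg sE₀)
  have y1 := (neg_abs_le _).trans' (neg_le_neg sE₁)
  have z0 := (le_abs_self _).trans (sB 0)
  have z1 := (le_abs_self _).trans (sB 1)
  linarith

/-! ### The current generated by a density of compact support -/

section Slab

set_option linter.unusedSectionVars false

variable {Y : Type*} [NormedAddCommGroup Y] [NormedSpace ℝ Y] [MeasureSpace Y]
  [BorelSpace Y] [FiniteDimensional ℝ Y] [(volume : Measure Y).IsAddHaarMeasure] {T : ℝ}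

theorem integrable_of_memLp_top_of_support {u : ℝ × Y → ℝ} {r : ℝ}
    (hu : MemLp u ∞ (volume.restrict (slab T Y)))
    (hr : ∀ᵐ z ∂(volume.restrict (slab T Y)), u z ≠ 0 → ‖z.2‖ ≤ r) :
    Integrable u (volume.restrict (slab T Y)) := by
  have hk : Integrable (fun z : ℝ × Y =>
      (1 : ℝ) * (Metric.closedBall (0 : Y) r).indicator (fun _ => (1 : ℝ)) z.2)
      (volume.restrict (slab T Y)) := by
    rw [volume_restrict_slab]
    exact Integrable.mul_prod (f := fun _ : ℝ => (1 : ℝ)) (integrable_const 1)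
      (integrable_indicator_closedBall r)
  refine (integrable_mul_of_memLp_top hu hk).congr ?_
  filter_upwards [hr] with z hz
  by_cases h0 : u z = 0
  · simp [h0]
  · rw [indicator_of_mem (by simpa using hz h0), one_mul, mul_one]

theorem ae_eq_of_integral_sq_eq_zero {u u' : ℝ × Y → ℝ}
    (hi : Integrable (fun z => (u z - u' z) ^ 2) (volume.restrict (slab T Y)))
    (h0 : ∫ z in slab T Y, (u z - u' z) ^ 2 = 0) :
    u =ᵐ[volume.restrict (slab T Y)] u' := by
  have := (integral_eq_zero_iff_of_nonneg (fun z => sq_nonneg _) hi).1 h0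
  filter_upwards [this] with z hz
  exact sub_eq_zero.1 (pow_eq_zero_iff two_ne_zero |>.1 hz)

end Slab

/-- From $|\widehat p_i|\le1$ and $2|s||d|\le s^2+d^2$ on the momentum ball, whose volume multiplies
$s^2$. The quantifier over $s$ sits inside the almost everywhere statement so that $s$ may later be
the field difference at $w$. -/
theorem abs_mul_currentDensity_sub_le {T r : ℝ} {f f' : ℝ × Plane × Plane → ℝ}
    (hf : Integrable f (volume.restrict (slab T (Plane × Plane))))
    (hf' : Integrable f' (volume.restrict (slab T (Plane × Plane))))
    (hd2 : Integrable (fun z => (f z - f' z) ^ 2) (volume.restrict (slab T (Plane × Plane))))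
    (hr : ∀ᵐ z ∂(volume.restrict (slab T (Plane × Plane))), f z - f' z ≠ 0 → ‖z.2.2‖ < r)
    (i : Fin 2) :
    ∀ᵐ w ∂(volume.restrict (slab T Plane)), ∀ s : ℝ,
      |s * (currentDensity f i w - currentDensity f' i w)| ≤
        2 * Real.pi * ((∫ p, (Metric.closedBall (0 : Plane) r).indicator (fun _ => (1 : ℝ)) p) *
          s ^ 2 + ∫ p, (f (w.1, w.2, p) - f' (w.1, w.2, p)) ^ 2) := by
  filter_upwards [ae_integrable_slab hf, ae_integrable_slab hf', ae_integrable_slab hd2,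
    ae_ae_of_ae_slab hr] with w h1 h2 h3 h4 s
  have hv : ∀ {g : Plane → ℝ}, Integrable g → Integrable (fun p => vel p i * g p) := fun hg =>
    hg.bdd_mul (c := 1) (contDiff_vel i).continuous.aestronglyMeasurable
      (Eventually.of_forall fun p => abs_vel_le_one p i)
  have e : s * (currentDensity f i w - currentDensity f' i w) =
      4 * Real.pi * ∫ p, s * (vel p i * (f (w.1, w.2, p) - f' (w.1, w.2, p))) := by
    simp only [currentDensity, mul_sub]
    rw [integral_sub ((hv h1).const_mul s) ((hv h2).const_mul s), integral_const_mul,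
      integral_const_mul]
    ring
  have hk := integrable_indicator_closedBall (Y := Plane) r
  have hb : ‖∫ p, s * (vel p i * (f (w.1, w.2, p) - f' (w.1, w.2, p)))‖ ≤
      ∫ p, (1 / 2 : ℝ) * ((Metric.closedBall (0 : Plane) r).indicator (fun _ => (1 : ℝ)) p * s ^ 2
        + (f (w.1, w.2, p) - f' (w.1, w.2, p)) ^ 2) := by
    refine norm_integral_le_of_norm_le (((hk.mul_const _).fun_add h3).const_mul _) ?_
    filter_upwards [h4] with p hp
    by_cases h0 : f (w.1, w.2, p) - f' (w.1, w.2, p) = 0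
    · rw [h0]
      have : 0 ≤ (Metric.closedBall (0 : Plane) r).indicator (fun _ => (1 : ℝ)) p :=
        indicator_nonneg (fun _ _ => zero_le_one) p
      simp only [mul_zero, norm_zero]
      positivity
    · rw [indicator_of_mem (by simpa using (hp h0).le), norm_mul, norm_mul, one_mul]
      simp only [Real.norm_eq_abs]
      rw [← sq_abs s, ← sq_abs (f (w.1, w.2, p) - f' (w.1, w.2, p))]
      have h5 := mul_le_mul_of_nonneg_right (abs_vel_le_one p i)
        (abs_nonneg (f (w.1, w.2, p) - f' (w.1, w.2, p)))
      have h6 := mul_le_mul_of_nonneg_left h5 (abs_nonneg s)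
      nlinarith [sq_nonneg (|s| - |f (w.1, w.2, p) - f' (w.1, w.2, p)|)]
  rw [integral_const_mul (1 / 2 : ℝ), integral_add (hk.mul_const _) h3, integral_mul_const] at hb
  rw [e, abs_mul, abs_of_nonneg (by positivity), ← Real.norm_eq_abs]
  have := mul_le_mul_of_nonneg_left hb (show 0 ≤ 4 * Real.pi by positivity)
  linarith

/-! ### Uniqueness -/

theorem MemW1.hasWeakDeriv_sub {V : Type*} [NormedAddCommGroup V] [NormedSpace ℝ V]
    [MeasureSpace V] [BorelSpace V] [FiniteDimensional ℝ V]
    [(volume : Measure V).IsAddHaarMeasure] {Ω : Set V} (hΩ : IsOpen Ω) {u w : V → ℝ}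
    (hu : MemW1 Ω ∞ u) (hw : MemW1 Ω ∞ w) (v : V) :
    HasWeakDeriv Ω v (fun z => u z - w z) (fun z => weakDeriv Ω v u z - weakDeriv Ω v w z) ∧
      MemLp (fun z => weakDeriv Ω v u z - weakDeriv Ω v w z) ∞ (volume.restrict Ω) :=
  ⟨(hu.hasWeakDeriv v).sub (hw.hasWeakDeriv v) hu.1 (hu.memLp_weakDeriv hΩ v) hw.1
    (hw.memLp_weakDeriv hΩ v), (hu.memLp_weakDeriv hΩ v).sub (hw.memLp_weakDeriv hΩ v)⟩

theorem integrable_sub_sq {X : Type*} [MeasurableSpace X] {μ : Measure X} {u w : X → ℝ}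
    (hu : MemLp u 2 μ) (hw : MemLp w 2 μ) : Integrable (fun z => (u z - w z) ^ 2) μ :=
  (hu.sub hw).integrable_sq

section Uniqueness

variable {T : ℝ} {U : ℝ × Plane → Plane} {f₀ : Plane × Plane → ℝ} {E₀ : Plane → Plane}
  {B₀ : Plane → ℝ} {f f' : ℝ × Plane × Plane → ℝ} {E E' : ℝ × Plane → Plane}
  {B B' : ℝ × Plane → ℝ}

theorem IsSolution.field_energy_sub
    (hreg : IsRegular T f E B) (hsol : IsSolution T U f₀ E₀ B₀ f E B)
    (hreg' : IsRegular T f' E' B') (hsol' : IsSolution T U f₀ E₀ B₀ f' E' B')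
    {Q N : ℝ × Plane → ℝ} {V : ℝ} (hV : 0 ≤ V)
    (hQeq : ∀ z, Q z = (E z 0 - E' z 0) ^ 2 + (E z 1 - E' z 1) ^ 2 + (B z - B' z) ^ 2)
    (hQ : Integrable Q (volume.restrict (slab T Plane)))
    (hN : Integrable N (volume.restrict (slab T Plane))) (hN0 : ∀ z, 0 ≤ N z)
    (hJ : ∀ i, ∀ᵐ w ∂(volume.restrict (slab T Plane)), ∀ s : ℝ,
      |s * (currentDensity f i w - currentDensity f' i w)| ≤ 2 * Real.pi * (V * s ^ 2 + N w)) :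
    ∃ C : ℝ, ∀ ψ, IsTimeTest T ψ →
      - ∫ z in slab T Plane, Q z * deriv ψ z.1 ≤
        C * (∫ z in slab T Plane, Q z * ψ z.1) +
          8 * Real.pi * ∫ z in slab T Plane, N z * ψ z.1 := by
  have hΩ : IsOpen (slab T Plane) := isOpen_slab T
  have dE := fun i v => (hreg.E_lipschitz i).hasWeakDeriv_sub hΩ (hreg'.E_lipschitz i) v
  have dB := fun v => hreg.B_lipschitz.hasWeakDeriv_sub hΩ hreg'.B_lipschitz v
  have mE := fun i => (hreg.E_lipschitz i).1.sub (hreg'.E_lipschitz i).1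
  have mB := hreg.B_lipschitz.1.sub hreg'.B_lipschitz.1
  have hQ0 : ∀ z, 0 ≤ Q z := fun z => by rw [hQeq]; positivity
  obtain ⟨C, hC⟩ := field_energy (Q := Q)
    -- Sum of the current bounds for the two components with $s=e_i$; $e_1^2+e_2^2\le Q$ is used in
    -- the first term.
    (G := fun z => 2 * Real.pi * (V * Q z) + 4 * Real.pi * N z)
    (dE 0 (1, 0)).1 (dE 1 (1, 0)).1 (dB (1, 0)).1 (dE 0 (0, basisVec 1)).1
    (dE 1 (0, basisVec 0)).1 (dB (0, basisVec 0)).1 (dB (0, basisVec 1)).1 (mE 0) (mE 1) mB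
    (dE 0 (1, 0)).2 (dE 1 (1, 0)).2 (dB (1, 0)).2 (dE 0 (0, basisVec 1)).2
    (dE 1 (0, basisVec 0)).2 (dB (0, basisVec 0)).2 (dB (0, basisVec 1)).2 hQ
    (((hQ.const_mul V).const_mul _).fun_add (hN.const_mul _))
    (fun z => by have := hQ0 z; have := hN0 z; positivity) hQeq (by
      filter_upwards [hsol.ampere_one, hsol'.ampere_one, hsol.ampere_two, hsol'.ampere_two,
        hsol.faraday, hsol'.faraday, hJ 0, hJ 1] with z a1 a1' a2 a2' b1 b1' j0 j1
      simp only [fieldDt, fieldDx] at a1 a1' a2 a2' b1 b1'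
      have k0 := (neg_le_abs _).trans (j0 (E z 0 - E' z 0))
      have k1 := (neg_le_abs _).trans (j1 (E z 1 - E' z 1))
      have hVQ : 2 * Real.pi * (V * ((E z 0 - E' z 0) ^ 2 + (E z 1 - E' z 1) ^ 2)) ≤
          2 * Real.pi * (V * Q z) := by
        rw [hQeq]
        exact mul_le_mul_of_nonneg_left (mul_le_mul_of_nonneg_left
          (le_add_of_nonneg_right (sq_nonneg _)) hV) (by positivity)
      linear_combination k0 + k1 + hVQ + (E z 0 - E' z 0) * (a1 - a1') +
        (E z 1 - E' z 1) * (a2 - a2') + (B z - B' z) * (b1 - b1'))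
  refine ⟨C + 4 * Real.pi * V, fun ψ hψ => (hC ψ hψ).trans_eq ?_⟩
  have e : ∀ z : ℝ × Plane, (2 * Real.pi * (V * Q z) + 4 * Real.pi * N z) * ψ z.1 =
      2 * Real.pi * V * (Q z * ψ z.1) + 4 * Real.pi * (N z * ψ z.1) := fun z => by ring
  simp_rw [e]
  rw [integral_add ((hψ.integrable_mul hQ).const_mul _) ((hψ.integrable_mul hN).const_mul _),
    integral_const_mul, integral_const_mul]
  ring

theorem IsSolution.vlasov_energy_sub
    (hreg : IsRegular T f E B) (hsol : IsSolution T U f₀ E₀ B₀ f E B)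
    (hreg' : IsRegular T f' E' B') (hsol' : IsSolution T U f₀ E₀ B₀ f' E' B')
    {Q : ℝ × Plane → ℝ} {r : ℝ}
    (hQeq : ∀ z, Q z = (E z 0 - E' z 0) ^ 2 + (E z 1 - E' z 1) ^ 2 + (B z - B' z) ^ 2)
    (hQ : Integrable Q (volume.restrict (slab T Plane)))
    (hsupp : ∀ᵐ z ∂(volume.restrict (slab T (Plane × Plane))),
      f z - f' z ≠ 0 → ‖z.2.1‖ < r ∧ ‖z.2.2‖ < r) :
    ∃ C C' : ℝ, ∀ ψ, IsTimeTest T ψ →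
      - ∫ z in slab T (Plane × Plane), (f z - f' z) ^ 2 * deriv ψ z.1 ≤
        C * (∫ z in slab T (Plane × Plane), (f z - f' z) ^ 2 * ψ z.1) +
          C' * ∫ z in slab T Plane, Q z * ψ z.1 := by
  have hΩ : IsOpen (slab T (Plane × Plane)) := isOpen_slab T
  have df := fun v => hreg.f_lipschitz.hasWeakDeriv_sub hΩ hreg'.f_lipschitz v
  -- The difference of the force terms is split as
  -- $F\cdot\partial_pf-F'\cdot\partial_pf'=F\cdot\partial_pd+(F-F')\cdot\partial_pf'$, so only the
  -- bounded $\partial_pf'$ meets the field difference.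
  refine vlasov_energy (e := fun i w => E w i - E' w i) (b := fun w => B w - B' w)
    (E := fun i w => E w i) (B := B) (Df := fun i => kinDp T i f')
    (df (1, 0, 0)).1 (fun i => (df (0, basisVec i, 0)).1) (fun i => (df (0, 0, basisVec i)).1)
    (hreg.f_lipschitz.1.sub hreg'.f_lipschitz.1) (df (1, 0, 0)).2
    (fun i => (df (0, basisVec i, 0)).2) (fun i => (df (0, 0, basisVec i)).2)
    (fun i => hreg'.f_lipschitz.memLp_weakDeriv hΩ _) (fun i => (hreg.E_lipschitz i).1)
    hreg.B_lipschitz.1 (integrable_sub_sq hreg.f_energy.1 hreg'.f_energy.1) hQ hQeq hsupp ?_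
  filter_upwards [hsol.vlasov, hsol'.vlasov] with z h1 h2
  simp only [Fin.sum_univ_two, PiLp.sub_apply, PiLp.smul_apply, smul_eq_mul, kinDt, kinDx, kinDp]
    at h1 h2 ⊢
  linear_combination h1 - h2

theorem IsSolution.ae_eq (hreg : IsRegular T f E B) (hsol : IsSolution T U f₀ E₀ B₀ f E B)
    (hreg' : IsRegular T f' E' B') (hsol' : IsSolution T U f₀ E₀ B₀ f' E' B') :
    f =ᵐ[volume.restrict (slab T (Plane × Plane))] f' ∧
      E =ᵐ[volume.restrict (slab T Plane)] E' ∧ B =ᵐ[volume.restrict (slab T Plane)] B' := by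
  obtain ⟨r₁, -, hr₁⟩ := hreg.support_f
  obtain ⟨r₂, -, hr₂⟩ := hreg'.support_f
  set r := max r₁ r₂ with hr
  have hsupp : ∀ᵐ z ∂(volume.restrict (slab T (Plane × Plane))),
      f z - f' z ≠ 0 → ‖z.2.1‖ < r ∧ ‖z.2.2‖ < r := by
    filter_upwards [hr₁, hr₂] with z h1 h2 h0
    by_cases hz : f z = 0
    · have := h2 fun h => h0 (by rw [hz, h, sub_zero])
      exact ⟨this.1.trans_le (le_max_right _ _), this.2.trans_le (le_max_right _ _)⟩
    · exact ⟨(h1 hz).1.trans_le (le_max_left _ _), (h1 hz).2.trans_le (le_max_left _ _)⟩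
  have hf1 := integrable_of_memLp_top_of_support hreg.f_lipschitz.1
    (hr₁.mono fun z hz h0 => (max_le (hz h0).1.le (hz h0).2.le : ‖z.2‖ ≤ r₁))
  -- The product carries the maximum norm, so bounds on $x$ and $p$ separately bound the pair.
  have hf1' := integrable_of_memLp_top_of_support hreg'.f_lipschitz.1
    (hr₂.mono fun z hz h0 => (max_le (hz h0).1.le (hz h0).2.le : ‖z.2‖ ≤ r₂))
  have hd2 := integrable_sub_sq hreg.f_energy.1 hreg'.f_energy.1
  have hE2 := fun i => integrable_sub_sq (hreg.E_energy i).1 (hreg'.E_energy i).1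
  have hB2 := integrable_sub_sq hreg.B_energy.1 hreg'.B_energy.1
  set Q : ℝ × Plane → ℝ := fun z =>
    (E z 0 - E' z 0) ^ 2 + (E z 1 - E' z 1) ^ 2 + (B z - B' z) ^ 2 with hQdef
  have hQ : Integrable Q (volume.restrict (slab T Plane)) :=
    ((hE2 0).fun_add (hE2 1)).fun_add hB2
  set V : ℝ := ∫ p, (Metric.closedBall (0 : Plane) r).indicator (fun _ => (1 : ℝ)) p with hV
  have hV0 : 0 ≤ V := integral_nonneg fun p => indicator_nonneg (fun _ _ => zero_le_one) p
  obtain ⟨C₁, hC₁⟩ := hsol.field_energy_sub hreg hreg' hsol' hV0 (fun _ => rfl) hQ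
    (integrable_integral_slab hd2) (fun z => integral_nonneg fun p => sq_nonneg _)
    (abs_mul_currentDensity_sub_le hf1 hf1' hd2 (hsupp.mono fun z hz h0 => (hz h0).2))
  obtain ⟨C₂, C₃, hC₂⟩ := hsol.vlasov_energy_sub hreg hreg' hsol' (fun _ => rfl) hQ hsupp
  obtain ⟨Nf, cf, zf, nf, If⟩ := hsol.initial_f.exists_norm_sq_sub hsol'.initial_f
  obtain ⟨N₁, c₁, z₁, n₁, I₁⟩ := (hsol.initial_E 0).exists_norm_sq_sub (hsol'.initial_E 0)
  obtain ⟨N₂, c₂, z₂, n₂, I₂⟩ := (hsol.initial_E 1).exists_norm_sq_sub (hsol'.initial_E 1)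
  obtain ⟨Nb, cb, zb, nb, Ib⟩ := hsol.initial_B.exists_norm_sq_sub hsol'.initial_B
  -- Stated for general bounded continuous $\eta$ because it is used with $\psi'$, with $\psi$ and
  -- finally with $\eta=1$.
  have hsum : ∀ {η : ℝ → ℝ} {C : ℝ}, Continuous η → (∀ t, |η t| ≤ C) →
      ∫ t in Ioo 0 T, (Nf t + N₁ t + N₂ t + Nb t) * η t =
        (∫ z in slab T (Plane × Plane), (f z - f' z) ^ 2 * η z.1) +
          ∫ z in slab T Plane, Q z * η z.1 := by
    intro η C hη hC
    obtain ⟨if1, if2⟩ := If η (integrable_mul_time hd2 hη hC)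
    obtain ⟨i11, i12⟩ := I₁ η (integrable_mul_time (hE2 0) hη hC)
    obtain ⟨i21, i22⟩ := I₂ η (integrable_mul_time (hE2 1) hη hC)
    obtain ⟨ib1, ib2⟩ := Ib η (integrable_mul_time hB2 hη hC)
    simp only [hQdef, add_mul]
    rw [integral_add ((if1.fun_add i11).fun_add i21) ib1, integral_add (if1.fun_add i11) i21,
      integral_add if1 i11,
      integral_add ((integrable_mul_time (hE2 0) hη hC).fun_add
        (integrable_mul_time (hE2 1) hη hC)) (integrable_mul_time hB2 hη hC),
      integral_add (integrable_mul_time (hE2 0) hη hC) (integrable_mul_time (hE2 1) hη hC),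
      if2, i12, i22, ib2]
    ring
  have hzero : ∀ t ∈ Ioo 0 T, Nf t + N₁ t + N₂ t + Nb t = 0 := by
    intro t ht
    refine eq_zero_of_weak_gronwall (N := fun t => Nf t + N₁ t + N₂ t + Nb t)
      -- The signs of the $C_i$ are unknown, hence the absolute values; $8\pi$ is the coupling of
      -- the density into the field estimate.
      (C := |C₁| + |C₂| + |C₃| + 8 * Real.pi)
      (((cf.add c₁).add c₂).add cb) (by simp [zf, z₁, z₂, zb])
      (fun t => add_nonneg (add_nonneg (add_nonneg (nf t) (n₁ t)) (n₂ t)) (nb t)) ?_ ht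
    intro ψ hψ
    obtain ⟨C, hC⟩ := hψ.exists_abs_le
    rw [hsum hψ.continuous_deriv fun t => (hC t).2,
      hsum hψ.contDiff.continuous fun t => (hC t).1]
    have h1 := hC₁ ψ hψ
    have h2 := hC₂ ψ hψ
    have hF : ∫ w in slab T Plane, (∫ p, (f (w.1, w.2, p) - f' (w.1, w.2, p)) ^ 2) * ψ w.1 =
        ∫ z in slab T (Plane × Plane), (f z - f' z) ^ 2 * ψ z.1 := by
      rw [integral_slab_prod (hψ.integrable_mul hd2)]
      simp only [integral_mul_const]
    rw [hF] at h1
    have hA : 0 ≤ ∫ z in slab T (Plane × Plane), (f z - f' z) ^ 2 * ψ z.1 :=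
      integral_nonneg fun z => mul_nonneg (sq_nonneg _) (hψ.nonneg _)
    have hF0 : 0 ≤ ∫ z in slab T Plane, Q z * ψ z.1 :=
      integral_nonneg fun z => mul_nonneg (by positivity) (hψ.nonneg _)
    generalize (∫ z in slab T (Plane × Plane), (f z - f' z) ^ 2 * ψ z.1) = A at *
    generalize (∫ z in slab T Plane, Q z * ψ z.1) = F at *
    have a1 := mul_le_mul_of_nonneg_right (le_abs_self C₁) hF0
    have a2 := mul_le_mul_of_nonneg_right (le_abs_self C₂) hA
    have a3 := mul_le_mul_of_nonneg_right (le_abs_self C₃) hF0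
    have b1 := mul_nonneg (abs_nonneg C₁) hA
    have b2 := mul_nonneg (abs_nonneg C₂) hF0
    have b3 := mul_nonneg (abs_nonneg C₃) hA
    have b4 := mul_nonneg Real.pi_pos.le hF0
    linarith
  have hint := hsum (η := fun _ => 1) (C := 1) continuous_const (by simp)
  have hint0 : ∫ t in Ioo 0 T, (Nf t + N₁ t + N₂ t + Nb t) * 1 = 0 := by
    rw [setIntegral_congr_fun measurableSet_Ioo
      (g := fun _ => 0) fun t ht => by simp only [hzero t ht, zero_mul]]
    simp
  simp only [mul_one] at hint hint0
  rw [hint0] at hint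
  have hA : 0 ≤ ∫ z in slab T (Plane × Plane), (f z - f' z) ^ 2 :=
    integral_nonneg fun z => sq_nonneg _
  have hE0 : ∀ i, 0 ≤ ∫ z in slab T Plane, (E z i - E' z i) ^ 2 := fun i =>
    integral_nonneg fun z => sq_nonneg _
  have hB0 : 0 ≤ ∫ z in slab T Plane, (B z - B' z) ^ 2 := integral_nonneg fun z => sq_nonneg _
  have hQsplit : ∫ z in slab T Plane, Q z = (∫ z in slab T Plane, (E z 0 - E' z 0) ^ 2) +
      (∫ z in slab T Plane, (E z 1 - E' z 1) ^ 2) + ∫ z in slab T Plane, (B z - B' z) ^ 2 := by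
    rw [← integral_add (hE2 0) (hE2 1), ← integral_add ((hE2 0).fun_add (hE2 1)) hB2]
  have := hE0 0
  have := hE0 1
  refine ⟨ae_eq_of_integral_sq_eq_zero hd2 (by linarith), ?_,
    ae_eq_of_integral_sq_eq_zero hB2 (by linarith)⟩
  filter_upwards [ae_eq_of_integral_sq_eq_zero (hE2 0) (by linarith),
    ae_eq_of_integral_sq_eq_zero (hE2 1) (by linarith)] with z h0 h1
  ext i
  fin_cases i
  · exact h0
  · exact h1

end Uniqueness

end VlasovMaxwell

theorem mainTheorem4 (T : ℝ) (hT : 0 < T)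
    (U : ℝ × VlasovMaxwell.Plane → VlasovMaxwell.Plane) (hU : VlasovMaxwell.IsControl T U)
    (f₀ : VlasovMaxwell.Plane × VlasovMaxwell.Plane → ℝ)
    (E₀ : VlasovMaxwell.Plane → VlasovMaxwell.Plane) (B₀ : VlasovMaxwell.Plane → ℝ)
    (f f' : ℝ × VlasovMaxwell.Plane × VlasovMaxwell.Plane → ℝ)
    (E E' : ℝ × VlasovMaxwell.Plane → VlasovMaxwell.Plane)
    (B B' : ℝ × VlasovMaxwell.Plane → ℝ)
    (hreg : VlasovMaxwell.IsRegular T f E B)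
    (hsol : VlasovMaxwell.IsSolution T U f₀ E₀ B₀ f E B)
    (hreg' : VlasovMaxwell.IsRegular T f' E' B')
    (hsol' : VlasovMaxwell.IsSolution T U f₀ E₀ B₀ f' E' B') :
    f =ᵐ[volume.restrict
        (VlasovMaxwell.slab T (VlasovMaxwell.Plane × VlasovMaxwell.Plane))] f' ∧
      E =ᵐ[volume.restrict (VlasovMaxwell.slab T VlasovMaxwell.Plane)] E' ∧
      B =ᵐ[volume.restrict (VlasovMaxwell.slab T VlasovMaxwell.Plane)] B' :=
  hsol.ae_eq hreg hreg' hsol'
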